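/- **Theorem 2.** A set $K\subset\mathbb{R}^2$ is called a *five-fold lattice tile* if there is a lattice $\Lambda\subset\mathbb{R}^2$ of rank two such that every point of the plane belongs to at least five of the translates $K+\lambda$ ($\lambda\in\Lambda$) and to at most five of the translates $\mathrm{int}(K)+\lambda$ ($\lambda\in\Lambda$). Let $W$ be the (solid) quadrilateral with vertices $(-\tfrac12,1)$, $(-\tfrac12,\tfrac34)$, $(-\tfrac23,\tfrac23)$, $(-\tfrac34,\tfrac34)$, and put $u_1=(0,1)$, $u_2=(1,1)$, $u_3=(\tfrac32,\tfrac12)$, $u_4=(\tfrac32,0)$, $u_5=(1,-\tfrac12)$ and $u_{5+i}=-u_i$ for $i=1,\dots,5$. 1. A centrally symmetric convex decagon whose ten edges have $u_1,\dots,u_{10}$ as their midpoints is a five-fold lattice tile if and only if one of its vertices lies in the interior of $W$. 2. For every point $w$ in the interior of $W$ there is exactly one centrally symmetric convex decagon whose ten edges have $u_1,\dots,u_{10}$ as their midpoints and which has $w$ as a vertex. 3. For a convex decagon $D$ the following are equivalent: (a) $D$ is a five-fold lattice tile; (b) some non-singular affine image of $D$ is a centrally symmetric convex decagon whose ten edges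 have $u_1,\dots,u_{10}$ as their midpoints; (c) some non-singular affine image of $D$ is such a decagon with a vertex in the interior of $W$. -/

import Mathlib

/-- The Euclidean plane. -/
abbrev Plane : Type := EuclideanSpace ℝ (Fin 2)

/-- `K + Λ` is a `k`-fold lattice tiling: every point lies in at least `k` of the translates of `K`
by points of `Λ`, and in at most `k` of the translates of the interior of `K`. -/
def IsKFoldTiling (k : ℕ) (K : Set Plane) (Λ : Submodule ℤ Plane) : Prop :=
  (∀ x : Plane, (k : ℕ∞) ≤ {l : Plane | l ∈ Λ ∧ x - l ∈ K}.encard) ∧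
  (∀ x : Plane, {l : Plane | l ∈ Λ ∧ x - l ∈ interior K}.encard ≤ (k : ℕ∞))

/-- `K` is a `k`-fold lattice tile: `K + Λ` is a `k`-fold tiling for some lattice `Λ` of rank two. -/
def IsKFoldLatticeTile (k : ℕ) (K : Set Plane) : Prop :=
  ∃ Λ : Submodule ℤ Plane, ∃ _ : DiscreteTopology Λ, IsZLattice ℝ Λ ∧ IsKFoldTiling k K Λ

/-- The cross product (signed area) of two plane vectors. -/
def cross (a b : Plane) : ℝ := a 0 * b 1 - a 1 * b 0

/-- `v 0, …, v 9` are the vertices of a convex decagon listed in cyclic order (indices mod 10):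
for each `i`, the eight points other than `v i` and `v (i + 1)` lie strictly on one side of the
line through `v i` and `v (i + 1)`, the same side for all `i` (left if the order is
counter-clockwise, right if it is clockwise). -/
def IsDecagonCycle (v : Fin 10 → Plane) : Prop :=
  (∀ i j : Fin 10, j ≠ i → j ≠ i + 1 → 0 < cross (v (i + 1) - v i) (v j - v i)) ∨
  (∀ i j : Fin 10, j ≠ i → j ≠ i + 1 → cross (v (i + 1) - v i) (v j - v i) < 0)

/-- The (solid) decagon with vertices `v 0, …, v 9`. -/
def decagon (v : Fin 10 → Plane) : Set Plane := convexHull ℝ (Set.range v)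

/-- The set of the midpoints of the edges `[v i, v (i + 1)]` of a decagon. -/
def edgeMidpoints (v : Fin 10 → Plane) : Set Plane :=
  Set.range fun i : Fin 10 => midpoint ℝ (v i) (v (i + 1))

/-- Central symmetry about some point. -/
def IsCentrallySymmetric (K : Set Plane) : Prop :=
  ∃ c : Plane, ∀ x ∈ K, Equiv.pointReflection c x ∈ K

/-- The ten prescribed points `u₁, …, u₅, -u₁, …, -u₅`. -/
def prescribedMidpoints : Set Plane :=
  {!₂[0, 1], !₂[1, 1], !₂[3 / 2, 1 / 2], !₂[3 / 2, 0], !₂[1, -1 / 2],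
    !₂[0, -1], !₂[-1, -1], !₂[-3 / 2, -1 / 2], !₂[-3 / 2, 0], !₂[-1, 1 / 2]}

/-- `v` lists, in cyclic order, the vertices of a centrally symmetric convex decagon whose ten edges
have the ten prescribed points as their midpoints. -/
def IsPrescribedDecagon (v : Fin 10 → Plane) : Prop :=
  IsDecagonCycle v ∧ IsCentrallySymmetric (decagon v) ∧ edgeMidpoints v = prescribedMidpoints

/-- The (solid) quadrilateral `W` with vertices `w₁, w₂, w₃, w₄`. -/
def quadW : Set Plane :=
  convexHull ℝ {!₂[-1 / 2, 1], !₂[-1 / 2, 3 / 4], !₂[-2 / 3, 2 / 3], !₂[-3 / 4, 3 / 4]}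

/-! A polygon is rebuilt from one vertex and its edge midpoints, since each vertex is the reflection
of its predecessor in a midpoint. The midpoints of a convex decagon are themselves in convex
position, so the prescribed ones can occur only in one cyclic order. Hence a prescribed decagon is
`stdDecagon w` for some `w`, and convexity of `stdDecagon w` amounts to `w ∈ interior quadW`
(`isPosCycle_stdDecagon_iff`, `exists_stdDecagon_of_isPrescribedDecagon`). Every one of these tiles
fivefold with the integer lattice: its boundary edges are matched in pairs by integer vectors, so
the counts over the vertical columns telescope to five (`isKFoldLatticeTile_stdDecagon`).

Conversely, let a decagon tile fivefold; after a linear map the lattice is the integer one. Crossing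
an edge at a generic point must not change the covering number, so what is lost through an edge is
regained through a parallel one. Thus each edge has an opposite edge of equal length, which is a
lattice translate of it unless the edge itself is a lattice vector
(`IsKFoldTiling.exists_opposite_edge`). Convexity then forces central symmetry
(`IsPosCycle.opposite_edge_eq`), and the packing condition bounds the area by five
(`IsKFoldTiling.sum_cross_diag_le`).

An exceptional edge, translated only up to sliding along itself, would make the area at least six
(`IsLatticeEdgeSystem.last_not_exceptional`). So all short diagonals `v (i + 2) - v i` are lattice
vectors. Their cross products are positive integers subject to linear relations, Plücker relations
and the area bound; a finite search determines the needed ones up to rotation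
(`cyclic_int_classification`). Short diagonals are twice the differences of consecutive midpoints,
so the midpoints are known up to an affine map (`IsPosCycle.exists_affineEquiv`). -/

/-! ### Algebra of the planar cross product. -/

section CrossAlgebra

variable (a b c d : Plane) (r : ℝ)

lemma cross_add_left : cross (a + b) c = cross a c + cross b c := by
  simp only [cross, PiLp.add_apply]; ring

lemma cross_add_right : cross a (b + c) = cross a b + cross a c := by
  simp only [cross, PiLp.add_apply]; ring

lemma cross_sub_right : cross a (b - c) = cross a b - cross a c := by
  simp only [cross, PiLp.sub_apply]; ring

lemma cross_neg_left : cross (-a) b = -cross a b := by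
  simp only [cross, PiLp.neg_apply]; ring

lemma cross_neg_right : cross a (-b) = -cross a b := by
  simp only [cross, PiLp.neg_apply]; ring

lemma cross_smul_left : cross (r • a) b = r * cross a b := by
  simp only [cross, PiLp.smul_apply, smul_eq_mul]; ring

lemma cross_smul_right : cross a (r • b) = r * cross a b := by
  simp only [cross, PiLp.smul_apply, smul_eq_mul]; ring

@[simp] lemma cross_same : cross a a = 0 := by
  simp only [cross]; ring

@[simp] lemma cross_zero_left : cross 0 a = 0 := by simp [cross]

@[simp] lemma cross_zero_right : cross a 0 = 0 := by simp [cross]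

lemma cross_swap : cross a b = -cross b a := by
  simp only [cross]; ring

lemma cross_pluecker :
    cross a c * cross b d = cross a b * cross c d + cross a d * cross b c := by
  simp only [cross]; ring

lemma cross_smul_eq : cross a b • c = cross c b • a + cross a c • b := by
  ext i
  fin_cases i <;> simp [cross] <;> ring

end CrossAlgebra

lemma plane_ext {a b : Plane} (h0 : a 0 = b 0) (h1 : a 1 = b 1) : a = b := by
  ext i; fin_cases i <;> assumption

lemma continuous_cross (a : Plane) : Continuous fun x : Plane => cross a x := by
  unfold cross; fun_prop

/-- A vector with vanishing cross product with a non-zero vector is a multiple of it. -/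
lemma exists_smul_of_cross_eq_zero {a b : Plane} (ha : a ≠ 0) (h : cross a b = 0) :
    ∃ r : ℝ, b = r • a := by
  by_cases h0 : a 0 = 0
  · have h1 : a 1 ≠ 0 := fun h1 => ha (plane_ext (by simpa using h0) (by simpa using h1))
    refine ⟨b 1 / a 1, plane_ext ?_ ?_⟩
    · have : a 1 * b 0 = 0 := by simp only [cross, h0] at h; linarith
      simp [h0, (mul_eq_zero.1 this).resolve_left h1]
    · simp [h1]
  · refine ⟨b 0 / a 0, plane_ext ?_ ?_⟩
    · simp [h0]
    · simp only [cross] at h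
      simp only [PiLp.smul_apply, smul_eq_mul]
      field_simp
      linarith

/-- An affine functional that is non-negative on a set is positive in its interior. -/
lemma cross_add_const_pos_of_mem_interior {a n x : Plane} {c : ℝ} {S : Set Plane}
    (hn : 0 < cross a n) (hS : ∀ y ∈ S, 0 ≤ cross a y + c) (hx : x ∈ interior S) :
    0 < cross a x + c := by
  refine (hS x (interior_subset hx)).lt_of_ne fun h0 => ?_
  have hc : Filter.Tendsto (fun ε : ℝ => x - ε • n) (nhdsWithin 0 (Set.Ioi 0)) (nhds x) := by
    have : Continuous fun ε : ℝ => x - ε • n := by fun_prop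
    simpa using (this.tendsto 0).mono_left nhdsWithin_le_nhds
  have h1 := hc.eventually (mem_interior_iff_mem_nhds.1 hx)
  obtain ⟨ε, hε, hpos⟩ := (h1.and self_mem_nhdsWithin).exists
  have := hS _ hε
  rw [cross_sub_right, cross_smul_right] at this
  have : 0 < ε * cross a n := mul_pos hpos hn
  linarith

/-! ### Convex decagons: orientation, half-planes and interior. -/

/-- Counter-clockwise convex decagons. -/
def IsPosCycle (v : Fin 10 → Plane) : Prop :=
  ∀ i j : Fin 10, j ≠ i → j ≠ i + 1 → 0 < cross (v (i + 1) - v i) (v j - v i)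

lemma IsPosCycle.shift {v : Fin 10 → Plane} (h : IsPosCycle v) (k : Fin 10) :
    IsPosCycle fun i => v (i + k) := by
  intro i j hji hji'
  have := h (i + k) (j + k) (by simpa using hji)
    (by rw [add_right_comm]; simpa using hji')
  simpa only [add_right_comm i 1 k] using this

/-- Vectors turning counter-clockwise step by step inside a half-plane are sorted by angle. -/
lemma cross_pos_of_chain (u : ℕ → Plane) (n : ℕ) (h1 : ∀ k, 1 < k → k ≤ n → 0 < cross (u 1) (u k))
    (hs : ∀ k, 1 ≤ k → k < n → 0 < cross (u k) (u (k + 1))) {k l : ℕ} (hk : 1 ≤ k) (hkl : k < l)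
    (hl : l ≤ n) : 0 < cross (u k) (u l) := by
  rcases hk.eq_or_lt with rfl | hk1
  · exact h1 l hkl hl
  induction l, hkl using Nat.le_induction with
  | base => exact hs k hk (by omega)
  | succ l hkl ih =>
    have ih := ih (by omega)
    -- The Plücker relation writes the wanted cross product, times a positive factor, as a sum of
    -- positive products.
    have e := cross_pluecker (u 1) (u k) (u l) (u (l + 1))
    have p1 := h1 l (by omega) (by omega)
    have p2 := h1 k hk1 (by omega)
    have p3 := h1 (l + 1) (by omega) hl
    have p4 := hs l (by omega) (by omega)
    have : 0 < cross (u 1) (u l) * cross (u k) (u (l + 1)) := by rw [e]; positivity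
    exact pos_of_mul_pos_right this p1.le

/-- Residues modulo ten. -/
def idx (k : ℕ) : Fin 10 := ⟨k % 10, Nat.mod_lt _ (by norm_num)⟩

lemma idx_ne {k l : ℕ} (hk : k < 10) (hl : l < 10) (h : k ≠ l) : idx k ≠ idx l := by
  intro e
  have := congrArg Fin.val e
  simp only [idx] at this
  omega

lemma idx_succ (k : ℕ) : idx (k + 1) = idx k + 1 := by
  ext
  simp [idx, Fin.val_add]

/-- The diagonals from a vertex, numbered counter-clockwise. -/
def diag (v : Fin 10 → Plane) (i : Fin 10) (k : ℕ) : Plane := v (i + idx k) - v i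

lemma add_idx_ne {k l : ℕ} (i : Fin 10) (hk : k < 10) (hl : l < 10) (h : k ≠ l) :
    i + idx k ≠ i + idx l := fun e => idx_ne hk hl h (add_left_cancel e)

lemma add_idx_zero (i : Fin 10) : i + idx 0 = i := add_zero i

lemma IsPosCycle.cross_diag_succ {v : Fin 10 → Plane} (h : IsPosCycle v) (i : Fin 10) {k : ℕ}
    (hk : 1 ≤ k) (hk9 : k < 9) : 0 < cross (diag v i k) (diag v i (k + 1)) := by
  have h1 := add_idx_ne i (show 0 < 10 by norm_num) (show k < 10 by omega) (by omega)
  have h2 := add_idx_ne i (show 0 < 10 by norm_num) (show k + 1 < 10 by omega) (by omega)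
  rw [add_idx_zero] at h1 h2
  rw [idx_succ, ← add_assoc] at h2
  have := h (i + idx k) i h1 h2
  unfold diag
  rw [idx_succ, ← add_assoc]
  convert this using 1
  simp only [cross, PiLp.sub_apply]; ring

/-- Any three vertices of a counter-clockwise decagon are positively oriented. -/
lemma IsPosCycle.cross_diag {v : Fin 10 → Plane} (h : IsPosCycle v) (i : Fin 10) {k l : ℕ}
    (hk : 1 ≤ k) (hkl : k < l) (hl : l ≤ 9) : 0 < cross (diag v i k) (diag v i l) := by
  refine cross_pos_of_chain (diag v i) 9 ?_ (fun k hk hk9 => h.cross_diag_succ i hk hk9) hk hkl hl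
  intro k hk hk9
  refine h i (i + idx k) ?_ (add_idx_ne i (by omega) (by norm_num) (by omega) : _ ≠ i + idx 1)
  have := add_idx_ne i (show k < 10 by omega) (show 0 < 10 by norm_num) (by omega)
  rwa [add_idx_zero] at this

/-- The linear functional cutting out the `i`-th edge of a decagon. -/
def edgeForm (v : Fin 10 → Plane) (i : Fin 10) (x : Plane) : ℝ := cross (v (i + 1) - v i) (x - v i)

lemma continuous_edgeForm (v : Fin 10 → Plane) (i : Fin 10) : Continuous (edgeForm v i) :=
  (continuous_cross _).comp (continuous_id.sub continuous_const)

lemma edgeForm_add (v : Fin 10 → Plane) (i : Fin 10) (x y : Plane) :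
    edgeForm v i (x + y) = edgeForm v i x + cross (v (i + 1) - v i) y := by
  simp only [edgeForm, cross, PiLp.sub_apply, PiLp.add_apply]; ring

lemma IsPosCycle.edgeForm_vertex_nonneg {v : Fin 10 → Plane} (h : IsPosCycle v) (i j : Fin 10) :
    0 ≤ edgeForm v i (v j) := by
  by_cases h1 : j = i
  · simp [edgeForm, h1]
  by_cases h2 : j = i + 1
  · simp [edgeForm, h2, cross_same]
  exact (h i j h1 h2).le

lemma IsPosCycle.edge_ne_zero {v : Fin 10 → Plane} (h : IsPosCycle v) (i : Fin 10) :
    v (i + 1) - v i ≠ 0 := by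
  intro e
  have := h i (i + 2) (by simp) (by simp)
  simp [e] at this

/-- Coordinates in a triangular sector. -/
lemma mem_convexHull_of_sector {p a b x : Plane} (hC : 0 < cross a b) (h1 : 0 ≤ cross a (x - p))
    (h2 : cross b (x - p) ≤ 0) (h3 : 0 ≤ cross (b - a) (x - p - a)) {s : Set Plane}
    (hp : p ∈ s) (ha : p + a ∈ s) (hb : p + b ∈ s) : x ∈ convexHull ℝ s := by
  have e := cross_smul_eq a b (x - p)
  set C := cross a b
  set β := cross a (x - p) / C
  set α := cross (x - p) b / C
  have hα : 0 ≤ α := div_nonneg (by rw [cross_swap]; linarith) hC.le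
  have hβ : 0 ≤ β := div_nonneg h1 hC.le
  have hαβ : α + β ≤ 1 := by
    rw [← add_div, div_le_one hC]
    have : cross (b - a) (x - p - a) = C - (cross (x - p) b + cross a (x - p)) := by
      simp only [C, cross, PiLp.sub_apply]; ring
    linarith
  have hx : x = (1 - α - β) • p + α • (p + a) + β • (p + b) := by
    have : x - p = α • a + β • b := by
      have := congrArg (fun y => C⁻¹ • y) e
      simp only [smul_add, smul_smul, inv_mul_cancel₀ hC.ne', one_smul] at this
      rw [this]
      simp only [α, β, div_eq_inv_mul]
    rw [← sub_add_cancel x p, this]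
    module
  rw [hx]
  have hm := fun (y : Plane) (hy : y ∈ s) => subset_convexHull ℝ s hy
  have := (convex_convexHull ℝ s).sum_mem (t := Finset.univ) (w := ![1 - α - β, α, β])
    (z := ![p, p + a, p + b]) (by intro i _; fin_cases i <;> simp <;> linarith)
    (by simp [Fin.sum_univ_three]; ring) (by intro i _; fin_cases i <;> simp [hm, hp, ha, hb])
  simpa [Fin.sum_univ_three] using this

/-- For the harder inclusion the decagon is fanned into triangles at `v 0`: a point satisfying all
edge inequalities lies between two consecutive diagonals, and the edge joining their ends closes off
the triangle. -/
lemma decagon_eq_of_isPosCycle {v : Fin 10 → Plane} (h : IsPosCycle v) :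
    decagon v = {x | ∀ i, 0 ≤ edgeForm v i x} := by
  apply Set.Subset.antisymm
  · refine convexHull_min ?_ ?_
    · rintro _ ⟨j, rfl⟩ i
      exact h.edgeForm_vertex_nonneg i j
    · intro x hx y hy a b ha hb hab i
      have e : edgeForm v i (a • x + b • y) = a * edgeForm v i x + b * edgeForm v i y := by
        obtain rfl : b = 1 - a := by linarith
        simp only [edgeForm, cross, PiLp.sub_apply, PiLp.add_apply, PiLp.smul_apply, smul_eq_mul]
        ring
      rw [e]
      have := hx i
      have := hy i
      positivity
  · intro x hx
    -- A discrete intermediate value argument: edge 0 puts `x` to the left of the first diagonal,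
    -- edge 9 puts it to the right of the last, so the side changes somewhere.
    have key : ∃ k, 1 ≤ k ∧ k < 9 ∧ 0 ≤ cross (diag v 0 k) (x - v 0) ∧
        cross (diag v 0 (k + 1)) (x - v 0) ≤ 0 := by
      by_contra! hc
      have : ∀ k, 1 ≤ k → k < 9 → 0 < cross (diag v 0 (k + 1)) (x - v 0) := by
        intro k hk
        induction k, hk using Nat.le_induction with
        | base =>
          intro _
          exact hc 1 le_rfl (by norm_num) (by have := hx 0; rwa [edgeForm] at this)
        | succ k hk ih =>
          intro hk9
          exact hc (k + 1) (by omega) hk9 (ih (by omega)).le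
      have h9 := this 8 (by norm_num) (by norm_num)
      have h9' := hx 9
      have e : edgeForm v 9 x = -cross (diag v 0 9) (x - v 0) := by
        simp only [edgeForm, diag, show (9 : Fin 10) + 1 = 0 by rfl, show idx 9 = 9 from rfl,
          zero_add,
          cross, PiLp.sub_apply]
        ring
      norm_num at h9
      linarith
    obtain ⟨k, hk, hk9, h1, h2⟩ := key
    refine mem_convexHull_of_sector (h.cross_diag_succ 0 hk hk9) h1 h2 ?_
      (Set.mem_range_self 0) (p := v 0) ?_ ?_
    · have := hx (idx k)
      simp only [diag, edgeForm, zero_add, idx_succ] at this ⊢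
      convert this using 2 <;> abel
    · simp [diag]
    · simp [diag]

lemma interior_decagon_of_isPosCycle {v : Fin 10 → Plane} (h : IsPosCycle v) :
    interior (decagon v) = {x | ∀ i, 0 < edgeForm v i x} := by
  rw [decagon_eq_of_isPosCycle h]
  apply Set.Subset.antisymm
  · intro x hx i
    have e : ∀ y, edgeForm v i y =
        cross (v (i + 1) - v i) y + -cross (v (i + 1) - v i) (v i) := by
      intro y; rw [edgeForm, cross_sub_right]; ring
    show 0 < edgeForm v i x
    rw [e]
    exact cross_add_const_pos_of_mem_interior
      (S := {x | ∀ i, 0 ≤ edgeForm v i x}) (h i (i + 2) (by simp) (by simp))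
      (fun y hy => (e y) ▸ hy i) hx
  · refine interior_maximal (fun x hx i => (hx i).le) ?_
    simp only [Set.ofPred_forall]
    exact isOpen_iInter_of_finite fun i => isOpen_lt continuous_const (continuous_edgeForm v i)

/-- A clockwise list is reversed by `i ↦ -i`; the new edge `i` is the old edge `-i - 1`. -/
lemma IsDecagonCycle.exists_isPosCycle {v : Fin 10 → Plane} (h : IsDecagonCycle v) :
    ∃ v' : Fin 10 → Plane, IsPosCycle v' ∧ Set.range v' = Set.range v ∧
      edgeMidpoints v' = edgeMidpoints v := by
  rcases h with h | h
  · exact ⟨v, h, rfl, rfl⟩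
  refine ⟨fun i => v (-i), fun i j hi hj => ?_, ?_, ?_⟩
  · have h1 := h (-i - 1) (-j) (by decide +revert) (by decide +revert)
    simp only [show ∀ i : Fin 10, -i - 1 + 1 = -i by decide] at h1
    show 0 < cross (v (-(i + 1)) - v (-i)) (v (-j) - v (-i))
    rw [show -(i + 1) = -i - 1 from (by decide : ∀ i : Fin 10, -(i + 1) = -i - 1) i]
    have e : cross (v (-i - 1) - v (-i)) (v (-j) - v (-i)) =
      -cross (v (-i) - v (-i - 1)) (v (-j) - v (-i - 1)) := by
      simp only [cross, PiLp.sub_apply]; ring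
    rw [e]; linarith
  · exact (Equiv.neg (Fin 10)).surjective.range_comp v
  · unfold edgeMidpoints
    rw [← ((Equiv.neg (Fin 10)).trans (Equiv.subRight 1)).surjective.range_comp
      (fun i => midpoint ℝ (v i) (v (i + 1)))]
    congr 1
    ext1 i
    simp only [Function.comp, Equiv.trans_apply, Equiv.neg_apply, Equiv.subRight_apply,
      show ∀ i : Fin 10, -i - 1 + 1 = -i by decide]
    rw [midpoint_comm, show -(i + 1) = -i - 1 from (by decide : ∀ i : Fin 10, -(i + 1) = -i - 1) i]

/-! ### The quadrilateral and the family of decagons with prescribed midpoints. -/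

lemma mem_interior_quadW_iff (w : Plane) : w ∈ interior quadW ↔
    w 0 < -1 / 2 ∧ 2 < 2 * w 1 - w 0 ∧ 0 < w 0 + w 1 ∧ w 1 - w 0 < 3 / 2 := by
  constructor
  · intro hw
    have hsub : ∀ y ∈ quadW, y 0 ≤ -1 / 2 ∧ 2 ≤ 2 * y 1 - y 0 ∧ 0 ≤ y 0 + y 1 ∧
        y 1 - y 0 ≤ 3 / 2 := by
      intro y hy
      refine convexHull_min (t := {y : Plane | y 0 ≤ -1 / 2 ∧ 2 ≤ 2 * y 1 - y 0 ∧ 0 ≤ y 0 + y 1 ∧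
        y 1 - y 0 ≤ 3 / 2}) ?_ ?_ hy
      · rintro x (rfl | rfl | rfl | rfl) <;> norm_num
      · rintro x ⟨h1, h2, h3, h4⟩ y ⟨k1, k2, k3, k4⟩ a b ha hb hab
        obtain rfl : b = 1 - a := by linarith
        refine ⟨?_, ?_, ?_, ?_⟩ <;> simp only [PiLp.add_apply, PiLp.smul_apply, smul_eq_mul] <;>
          nlinarith
    have c1 := cross_add_const_pos_of_mem_interior (a := !₂[0, 1]) (n := !₂[-1, 0])
      (c := -1 / 2) (by simp [cross])
      (fun y hy => by have := hsub y hy; simp [cross]; linarith) hw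
    have c2 := cross_add_const_pos_of_mem_interior (a := !₂[2, 1]) (n := !₂[-1, 0])
      (c := -2) (by simp [cross])
      (fun y hy => by have := hsub y hy; simp [cross]; linarith) hw
    have c3 := cross_add_const_pos_of_mem_interior (a := !₂[1, -1]) (n := !₂[1, 0])
      (c := 0) (by simp [cross])
      (fun y hy => by have := hsub y hy; simp [cross]; linarith) hw
    have c4 := cross_add_const_pos_of_mem_interior (a := !₂[-1, -1]) (n := !₂[1, 0])
      (c := 3 / 2) (by simp [cross])
      (fun y hy => by have := hsub y hy; simp [cross]; linarith) hw
    simp [cross] at c1 c2 c3 c4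
    refine ⟨?_, ?_, ?_, ?_⟩ <;> linarith
  · rintro hw
    refine interior_maximal (s := quadW) (t := {w : Plane | w 0 < -1 / 2 ∧ 2 < 2 * w 1 - w 0 ∧
      0 < w 0 + w 1 ∧ w 1 - w 0 < 3 / 2}) ?_ ?_ hw
    · rintro x ⟨h1, h2, h3, h4⟩
      -- The diagonal from `(-1/2, 1)` to `(-2/3, 2/3)` cuts the quadrilateral into two triangles.
      rcases le_total (cross !₂[-1 / 6, -1 / 3] (x - !₂[-1 / 2, 1])) 0 with h | h
      · refine mem_convexHull_of_sector (p := !₂[-1 / 2, 1]) (a := !₂[-1 / 4, -1 / 4])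
          (b := !₂[-1 / 6, -1 / 3]) ?_ ?_ h ?_ ?_ ?_ ?_
        · norm_num [cross]
        · simp [cross]; linarith
        · simp [cross]; linarith
        · simp
        · right; right; right; ext i; fin_cases i <;> norm_num
        · right; right; left; ext i; fin_cases i <;> norm_num
      · refine mem_convexHull_of_sector (p := !₂[-1 / 2, 1]) (a := !₂[-1 / 6, -1 / 3])
          (b := !₂[0, -1 / 4]) ?_ h ?_ ?_ ?_ ?_ ?_
        · norm_num [cross]
        · simp [cross]; linarith
        · simp [cross]; linarith
        · simp
        · right; right; left; ext i; fin_cases i <;> norm_num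
        · right; left; ext i; fin_cases i <;> norm_num
    · have c0 : Continuous fun w : Plane => w 0 := by fun_prop
      have c1 : Continuous fun w : Plane => w 1 := by fun_prop
      exact (isOpen_lt c0 continuous_const).inter <|
        (isOpen_lt continuous_const ((continuous_const.mul c1).sub c0)).inter <|
        (isOpen_lt continuous_const (c0.add c1)).inter (isOpen_lt (c1.sub c0) continuous_const)

/-- The prescribed midpoints in counter-clockwise order. -/
noncomputable def cyclicMidpoint : Fin 10 → Plane :=
  ![!₂[-1, 1 / 2], !₂[-3 / 2, 0], !₂[-3 / 2, -1 / 2], !₂[-1, -1], !₂[0, -1],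
    !₂[1, -1 / 2], !₂[3 / 2, 0], !₂[3 / 2, 1 / 2], !₂[1, 1], !₂[0, 1]]

lemma range_cyclicMidpoint : Set.range cyclicMidpoint = prescribedMidpoints := by
  ext x
  simp only [Set.mem_range, prescribedMidpoints, Set.mem_insert_iff, Set.mem_singleton_iff,
    cyclicMidpoint, Fin.exists_fin_succ]
  simp [eq_comm]
  tauto

/-- The decagon with a given vertex `w` and the prescribed midpoints. -/
noncomputable def stdDecagon (w : Plane) : Fin 10 → Plane :=
  ![!₂[w 0, w 1], !₂[-2 - w 0, 1 - w 1], !₂[-1 + w 0, -1 + w 1], !₂[-2 - w 0, -w 1],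
    !₂[w 0, -2 + w 1], !₂[-w 0, -w 1], !₂[2 + w 0, -1 + w 1], !₂[1 - w 0, 1 - w 1],
    !₂[2 + w 0, w 1], !₂[-w 0, 2 - w 1]]

lemma stdDecagon_zero (w : Plane) : stdDecagon w 0 = w := by
  apply plane_ext <;> simp [stdDecagon]

lemma stdDecagon_succ (w : Plane) (i : Fin 10) :
    stdDecagon w (i + 1) = (2 : ℝ) • cyclicMidpoint i - stdDecagon w i := by
  fin_cases i <;> apply plane_ext <;> simp [stdDecagon, cyclicMidpoint] <;> ring

lemma stdDecagon_add_five (w : Plane) (i : Fin 10) : stdDecagon w (i + 5) = -stdDecagon w i := by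
  fin_cases i <;> apply plane_ext <;> simp [stdDecagon] <;> ring

lemma isPosCycle_cyclicMidpoint : IsPosCycle cyclicMidpoint := by
  intro i j hi hj
  fin_cases i <;> fin_cases j <;> first
    | exact absurd rfl hi
    | exact absurd rfl hj
    | (simp [cyclicMidpoint, cross]; try norm_num)

/-- Each vertex is `w` or `-w` plus a constant, so the quadratic terms of every orientation
determinant cancel and the conditions are affine in `w`. The consecutive triples starting at
vertices 0, 1, 2 and 4 give exactly the four sides of the quadrilateral; these imply all the others.
-/
lemma isPosCycle_stdDecagon_iff (w : Plane) :
    IsPosCycle (stdDecagon w) ↔ w ∈ interior quadW := by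
  rw [mem_interior_quadW_iff]
  constructor
  · intro h
    have h0 := h 0 2 (by decide) (by decide)
    have h1 := h 1 3 (by decide) (by decide)
    have h2 := h 2 4 (by decide) (by decide)
    have h4 := h 4 6 (by decide) (by decide)
    simp [stdDecagon, cross] at h0 h1 h2 h4
    refine ⟨?_, ?_, ?_, ?_⟩ <;> linarith
  · rintro ⟨h1, h2, h3, h4⟩ i j hi hj
    fin_cases i <;> fin_cases j <;> first
      | exact absurd rfl hi
      | exact absurd rfl hj
      | (simp [stdDecagon, cross]; linarith)

lemma midpoint_eq_smul (a b : Plane) : midpoint ℝ a b = (1 / 2 : ℝ) • (a + b) := by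
  rw [midpoint_eq_smul_add]; norm_num

lemma exists_eq_add_idx (i j : Fin 10) : ∃ k < 10, j = i + idx k :=
  ⟨(j - i).val, (j - i).isLt, by revert i j; decide⟩

/-- The midpoints of the edges of a convex decagon form a convex decagon. -/
lemma IsPosCycle.midpoints {v : Fin 10 → Plane} (h : IsPosCycle v) :
    IsPosCycle fun i => midpoint ℝ (v i) (v (i + 1)) := by
  intro i j hi hj
  obtain ⟨k, hk, rfl⟩ := exists_eq_add_idx i j
  have k0 : k ≠ 0 := by rintro rfl; exact hi (add_idx_zero i)
  have k1 : k ≠ 1 := by rintro rfl; exact hj rfl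
  have e : cross (midpoint ℝ (v (i + 1)) (v (i + 1 + 1)) - midpoint ℝ (v i) (v (i + 1)))
      (midpoint ℝ (v (i + idx k)) (v (i + idx k + 1)) - midpoint ℝ (v i) (v (i + 1))) =
      1 / 4 * (cross (diag v i 2) (diag v i k) + cross (diag v i 2) (diag v i (k + 1)) +
        cross (diag v i 1) (diag v i 2)) := by
    have h2 : diag v i 2 = v (i + 1 + 1) - v i := by
      rw [diag, add_assoc i 1 1]; rfl
    have h1 : diag v i 1 = v (i + 1) - v i := rfl
    rw [h2, h1, diag, diag, idx_succ, ← add_assoc i]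
    simp only [midpoint_eq_smul, cross, PiLp.sub_apply, PiLp.add_apply, PiLp.smul_apply,
      smul_eq_mul]
    ring
  show 0 < cross (midpoint ℝ (v (i + 1)) (v (i + 1 + 1)) - midpoint ℝ (v i) (v (i + 1)))
      (midpoint ℝ (v (i + idx k)) (v (i + idx k + 1)) - midpoint ℝ (v i) (v (i + 1)))
  rw [e]
  have c1 : 0 ≤ cross (diag v i 2) (diag v i k) := by
    rcases eq_or_ne k 2 with rfl | k2
    · rw [cross_same]
    · exact (h.cross_diag i (by norm_num) (by omega) (by omega)).le
  have c2 : 0 ≤ cross (diag v i 2) (diag v i (k + 1)) := by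
    rcases eq_or_ne k 9 with rfl | k9
    · have : diag v i (9 + 1) = 0 := by
        rw [diag, show idx (9 + 1) = 0 from rfl, add_zero, sub_self]
      rw [this, cross_zero_right]
    · exact (h.cross_diag i (by norm_num) (by omega) (by omega)).le
  have c3 := h.cross_diag i (k := 1) (l := 2) le_rfl (by norm_num) (by norm_num)
  linarith

/-- Points in convex position have only one counter-clockwise order. -/
lemma IsPosCycle.eq_shift_of_range_eq {u v : Fin 10 → Plane} (hu : IsPosCycle u)
    (hv : IsPosCycle v) (h : Set.range v = Set.range u) : ∃ k, ∀ i, v i = u (i + k) := by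
  have hπ : ∀ i, ∃ a, u a = v i := fun i => h.subset (Set.mem_range_self i)
  choose π hπ using hπ
  have step : ∀ i, π (i + 1) = π i + 1 := by
    intro i
    by_contra hne
    have hne' : π (i + 1) ≠ π i := fun e => hv.edge_ne_zero i (by rw [← hπ, ← hπ, e, sub_self])
    -- If the successor of `v i` were another point of `u`, the `u`-successor would lie strictly to
    -- the right of the edge from `v i` to `v (i + 1)`, against the orientation of `v`.
    obtain ⟨j, hj⟩ := h.superset (Set.mem_range_self (π i + 1))
    have hp := hu (π i) (π (i + 1)) hne' hne
    rw [hπ, hπ, ← hj] at hp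
    have hj0 : j ≠ i := by rintro rfl; simp at hp
    have hj1 : j ≠ i + 1 := by rintro rfl; simp [cross_same] at hp
    have := hv i j hj0 hj1
    rw [cross_swap] at this
    linarith
  refine ⟨π 0, fun i => ?_⟩
  have : ∀ k, π (idx k) = idx k + π 0 := by
    intro k
    induction k with
    | zero => simp [show idx 0 = 0 from rfl]
    | succ k ih => rw [idx_succ, step, ih, add_right_comm]
  obtain ⟨k, -, rfl⟩ := exists_eq_add_idx 0 i
  rw [zero_add, ← this, hπ]

/-- Both the midpoints of `v`, suitably oriented, and `cyclicMidpoint` are counter-clockwise lists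
of the same convex set, hence agree up to a shift. Iterated reflection in the midpoints then
reproduces `stdDecagon`. -/
lemma exists_stdDecagon_of_isPrescribedDecagon {v : Fin 10 → Plane} (h : IsPrescribedDecagon v) :
    ∃ w ∈ interior quadW, Set.range (stdDecagon w) = Set.range v := by
  obtain ⟨hc, -, hm⟩ := h
  obtain ⟨u, hu, hur, hum⟩ := hc.exists_isPosCycle
  obtain ⟨k, hk⟩ := isPosCycle_cyclicMidpoint.eq_shift_of_range_eq hu.midpoints
    (by rw [range_cyclicMidpoint, ← hm, ← hum]; rfl)
  have hs : ∀ i, u (i - k + 1) = (2 : ℝ) • cyclicMidpoint i - u (i - k) := by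
    intro i
    have := hk (i - k)
    rw [sub_add_cancel, midpoint_eq_smul] at this
    rw [← this]; module
  have he : stdDecagon (u (0 - k)) = fun i => u (i - k) := by
    ext1 i
    have : ∀ n, stdDecagon (u (0 - k)) (idx n) = u (idx n - k) := by
      intro n
      induction n with
      | zero => exact stdDecagon_zero _
      | succ n ih => rw [idx_succ, stdDecagon_succ, ih, ← hs, sub_add_eq_add_sub]
    obtain ⟨n, -, rfl⟩ := exists_eq_add_idx 0 i
    rw [zero_add, this]
  refine ⟨u (0 - k), ?_, ?_⟩
  · rw [← isPosCycle_stdDecagon_iff, he]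
    simpa only [sub_eq_add_neg] using hu.shift (-k)
  · rw [he, ← hur]
    exact (Equiv.subRight k).surjective.range_comp u

/-- Central symmetry of the hull of vertices coming in opposite pairs. -/
lemma isCentrallySymmetric_decagon {v : Fin 10 → Plane} {c : Plane}
    (h : ∀ i, v (i + 5) = (2 : ℝ) • c - v i) : IsCentrallySymmetric (decagon v) := by
  refine ⟨c, fun x hx => ?_⟩
  have hr : (AffineEquiv.pointReflection ℝ c) '' Set.range v ⊆ Set.range v := by
    rintro _ ⟨_, ⟨i, rfl⟩, rfl⟩
    refine ⟨i + 5, ?_⟩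
    rw [h, AffineEquiv.pointReflection_apply, vsub_eq_sub, vadd_eq_add]
    module
  have := (AffineEquiv.pointReflection ℝ c).toAffineMap.image_convexHull (Set.range v)
  exact convexHull_mono hr (this.subset ⟨x, hx, rfl⟩)

lemma isPrescribedDecagon_stdDecagon {w : Plane} (hw : w ∈ interior quadW) :
    IsPrescribedDecagon (stdDecagon w) := by
  refine ⟨Or.inl ((isPosCycle_stdDecagon_iff w).2 hw),
    isCentrallySymmetric_decagon (c := 0) fun i => ?_, ?_⟩
  · rw [stdDecagon_add_five]; simp
  · rw [← range_cyclicMidpoint]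
    refine congrArg Set.range (funext fun i => ?_)
    rw [stdDecagon_succ, midpoint_eq_smul]
    module

/-- This gives uniqueness: the nine vertices of `stdDecagon w'` other than `w'` all violate one of
the inequalities of the quadrilateral. -/
lemma eq_of_mem_range_stdDecagon {w w' : Plane} (hw : w ∈ interior quadW)
    (hw' : w' ∈ interior quadW) (h : w ∈ Set.range (stdDecagon w')) : w' = w := by
  obtain ⟨i, rfl⟩ := h
  rw [mem_interior_quadW_iff] at hw hw'
  obtain ⟨h1, h2, h3, h4⟩ := hw
  obtain ⟨k1, k2, k3, k4⟩ := hw'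
  fin_cases i
  · exact (stdDecagon_zero w').symm
  all_goals
    exfalso
    simp [stdDecagon] at h1 h2 h3 h4
    linarith

/-- Each point of the open quadrilateral is a vertex of exactly one prescribed decagon. -/
lemma existsUnique_prescribed {w : Plane} (hw : w ∈ interior quadW) :
    ∃! D : Set Plane, ∃ v : Fin 10 → Plane, IsPrescribedDecagon v ∧ decagon v = D ∧
      ∃ i, v i = w := by
  refine ⟨decagon (stdDecagon w), ⟨_, isPrescribedDecagon_stdDecagon hw, rfl, 0,
    stdDecagon_zero w⟩, ?_⟩
  rintro D ⟨v, hv, rfl, i, rfl⟩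
  obtain ⟨w', hw', hr⟩ := exists_stdDecagon_of_isPrescribedDecagon hv
  obtain rfl := eq_of_mem_range_stdDecagon hw hw' (by rw [hr]; exact Set.mem_range_self i)
  rw [decagon, decagon, hr]

lemma exists_vertex_mem_interior_quadW {v : Fin 10 → Plane} (h : IsPrescribedDecagon v) :
    ∃ i, v i ∈ interior quadW := by
  obtain ⟨w, hw, hr⟩ := exists_stdDecagon_of_isPrescribedDecagon h
  obtain ⟨i, hi⟩ := hr.subset ⟨0, rfl⟩
  exact ⟨i, by rwa [hi, stdDecagon_zero]⟩

/-! ### The prescribed decagons tile: counting in vertical columns. -/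

/-- The height at abscissa `X` of the line through `a` and `b`. -/
noncomputable def lineAt (a b : Plane) (X : ℝ) : ℝ := a 1 + (b 1 - a 1) / (b 0 - a 0) * (X - a 0)

lemma mem_of_vertical {K : Set Plane} (hK : Convex ℝ K) {p q x : Plane} (hp : p ∈ K) (hq : q ∈ K)
    (hp0 : p 0 = x 0) (hq0 : q 0 = x 0) (h1 : p 1 ≤ x 1) (h2 : x 1 ≤ q 1) : x ∈ K := by
  rcases eq_or_lt_of_le (h1.trans h2) with h | h
  · have : p = x := plane_ext hp0 (by linarith)
    rwa [← this]
  · have hpos : 0 < q 1 - p 1 := by linarith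
    have := hK hp hq (a := (q 1 - x 1) / (q 1 - p 1)) (b := (x 1 - p 1) / (q 1 - p 1))
      (by apply div_nonneg <;> linarith) (by apply div_nonneg <;> linarith)
      (by field_simp; ring)
    convert this using 1
    apply plane_ext <;> simp only [PiLp.add_apply, PiLp.smul_apply, smul_eq_mul, hp0, hq0]
    · field_simp; ring
    · field_simp; ring

lemma lineAt_mem {K : Set Plane} (hK : Convex ℝ K) {a b : Plane} (ha : a ∈ K) (hb : b ∈ K)
    (hab : a 0 < b 0) {X : ℝ} (h1 : a 0 ≤ X) (h2 : X ≤ b 0) : !₂[X, lineAt a b X] ∈ K := by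
  have hpos : 0 < b 0 - a 0 := by linarith
  have := hK ha hb (a := (b 0 - X) / (b 0 - a 0)) (b := (X - a 0) / (b 0 - a 0))
    (by apply div_nonneg <;> linarith) (by apply div_nonneg <;> linarith) (by field_simp; ring)
  convert this using 1
  apply plane_ext <;> simp [lineAt] <;> field_simp <;> ring

lemma mem_of_between_lines {K : Set Plane} (hK : Convex ℝ K) {a b c d x : Plane} (ha : a ∈ K)
    (hb : b ∈ K) (hc : c ∈ K) (hd : d ∈ K) (hac : a 0 = c 0) (hbd : b 0 = d 0) (hab : a 0 < b 0)
    (h1 : a 0 ≤ x 0) (h2 : x 0 ≤ b 0) (h3 : lineAt a b (x 0) ≤ x 1)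
    (h4 : x 1 ≤ lineAt c d (x 0)) : x ∈ K :=
  mem_of_vertical hK (lineAt_mem hK ha hb hab h1 h2)
    (lineAt_mem hK hc hd (X := x 0) (by linarith) (by linarith) (by linarith)) (by simp) (by simp)
    (by simpa using h3) (by simpa using h4)

lemma lineAt_le_lineAt {a b c d : Plane} {X : ℝ} (hac : a 0 = c 0) (hbd : b 0 = d 0)
    (hab : a 0 < b 0) (h1 : a 0 ≤ X) (h2 : X ≤ b 0) (h3 : a 1 ≤ c 1) (h4 : b 1 ≤ d 1) :
    lineAt a b X ≤ lineAt c d X := by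
  have hpos : 0 < b 0 - a 0 := by linarith
  unfold lineAt
  rw [← hac, ← hbd]
  have e1 : ∀ p q : ℝ, p + (q - p) / (b 0 - a 0) * (X - a 0) =
      (p * (b 0 - X) + q * (X - a 0)) / (b 0 - a 0) := by intro p q; field_simp; ring
  rw [e1, e1]
  apply div_le_div_of_nonneg_right _ hpos.le
  have := mul_le_mul_of_nonneg_right h3 (show 0 ≤ b 0 - X by linarith)
  have := mul_le_mul_of_nonneg_right h4 (show 0 ≤ X - a 0 by linarith)
  linarith

lemma lineAt_translate {a b c d : Plane} {X Z p q : ℝ} (h1 : c 0 = a 0 + p) (h2 : d 0 = b 0 + p)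
    (h3 : c 1 = a 1 + q) (h4 : d 1 = b 1 + q) (hZ : Z = X + p) :
    lineAt c d Z = lineAt a b X + q := by
  unfold lineAt
  rw [h1, h2, h3, h4, hZ]
  ring_nf

lemma lineAt_lt_of_cross_pos {a b x : Plane} (hab : a 0 < b 0) (h : 0 < cross (b - a) (x - a)) :
    lineAt a b (x 0) < x 1 := by
  have hpos : 0 < b 0 - a 0 := by linarith
  simp only [cross, PiLp.sub_apply] at h
  unfold lineAt
  rw [div_mul_eq_mul_div, ← lt_sub_iff_add_lt', div_lt_iff₀ hpos]
  linarith

lemma lt_lineAt_of_cross_pos {a b x : Plane} (hab : a 0 < b 0) (h : 0 < cross (a - b) (x - b)) :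
    x 1 < lineAt a b (x 0) := by
  have hpos : 0 < b 0 - a 0 := by linarith
  simp only [cross, PiLp.sub_apply] at h
  unfold lineAt
  rw [div_mul_eq_mul_div, ← sub_lt_iff_lt_add', lt_div_iff₀ hpos]
  linarith

/-- The standard integer lattice. -/
noncomputable def intLattice : Submodule ℤ Plane :=
  Submodule.span ℤ (Set.range (EuclideanSpace.basisFun (Fin 2) ℝ).toBasis)

lemma mem_intLattice_iff (l : Plane) : l ∈ intLattice ↔ ∃ m n : ℤ, l = !₂[(m : ℝ), (n : ℝ)] := by
  unfold intLattice
  rw [Module.Basis.mem_span_iff_repr_mem]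
  constructor
  · intro h
    obtain ⟨m, hm⟩ := h 0
    obtain ⟨n, hn⟩ := h 1
    refine ⟨m, n, plane_ext ?_ ?_⟩
    · simpa using hm.symm
    · simpa using hn.symm
  · rintro ⟨m, n, rfl⟩ i
    fin_cases i
    · exact ⟨m, by simp⟩
    · exact ⟨n, by simp⟩

/-- Counting lattice points column by column. -/
lemma isKFoldLatticeTile_of_columns (k : ℕ) {K : Set Plane} (s : ℝ)
    (h : ∀ x : Plane, s ≤ x 0 → x 0 < s + 1 → ∃ (C : Finset ℤ) (A B : ℤ → ℤ),
      ∑ m ∈ C, (B m - A m).toNat = k ∧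
      (∀ m ∈ C, ∀ n, A m < n → n ≤ B m → x - !₂[(m : ℝ), (n : ℝ)] ∈ K) ∧
      (∀ m n : ℤ, x - !₂[(m : ℝ), (n : ℝ)] ∈ interior K → m ∈ C ∧ A m < n ∧ n ≤ B m)) :
    IsKFoldLatticeTile k K := by
  have key : ∀ x : Plane, ∃ S : Finset Plane, S.card = k ∧
      (∀ l ∈ S, l ∈ intLattice ∧ x - l ∈ K) ∧
      (∀ l ∈ intLattice, x - l ∈ interior K → l ∈ S) := by
    intro x
    set M := ⌊x 0 - s⌋
    have hM1 : (M : ℝ) ≤ x 0 - s := Int.floor_le _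
    have hM2 : x 0 - s < M + 1 := Int.lt_floor_add_one _
    obtain ⟨C, A, B, hsum, hcl, hint⟩ := h (x - !₂[(M : ℝ), 0]) (by simp; linarith)
      (by simp; linarith)
    let φ : (Σ _ : ℤ, ℤ) ↪ Plane := ⟨fun p => !₂[((M + p.1 : ℤ) : ℝ), (p.2 : ℝ)], by
      rintro ⟨m, n⟩ ⟨m', n'⟩ e
      have e0 := congrArg (fun y : Plane => y 0) e
      have e1 := congrArg (fun y : Plane => y 1) e
      simp at e0 e1
      rw [e0, e1]⟩
    have hφ : ∀ m n : ℤ, x - !₂[((M + m : ℤ) : ℝ), (n : ℝ)] =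
        x - !₂[(M : ℝ), 0] - !₂[(m : ℝ), (n : ℝ)] := by
      intro m n
      apply plane_ext <;> simp; ring
    refine ⟨(C.sigma fun m => Finset.Ioc (A m) (B m)).map φ, ?_, ?_, ?_⟩
    · rw [Finset.card_map, Finset.card_sigma, ← hsum]
      simp
    · intro l hl
      obtain ⟨⟨m, n⟩, hp, rfl⟩ := Finset.mem_map.1 hl
      simp only [Finset.mem_sigma, Finset.mem_Ioc] at hp
      refine ⟨(mem_intLattice_iff _).2 ⟨M + m, n, rfl⟩, ?_⟩
      show x - !₂[((M + m : ℤ) : ℝ), (n : ℝ)] ∈ K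
      rw [hφ]
      exact hcl m hp.1 n hp.2.1 hp.2.2
    · intro l hl hx
      obtain ⟨m, n, rfl⟩ := (mem_intLattice_iff _).1 hl
      refine Finset.mem_map.2 ⟨⟨m - M, n⟩, ?_, ?_⟩
      · simp only [Finset.mem_sigma, Finset.mem_Ioc]
        apply hint
        rw [← hφ, add_sub_cancel]
        exact hx
      · show !₂[((M + (m - M) : ℤ) : ℝ), (n : ℝ)] = _
        rw [add_sub_cancel]
  refine ⟨intLattice, inferInstanceAs (DiscreteTopology (Submodule.span ℤ _)),
    inferInstanceAs (IsZLattice ℝ (Submodule.span ℤ _)), fun x => ?_, fun x => ?_⟩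
  · obtain ⟨S, hS, h1, -⟩ := key x
    rw [← hS, ← Set.encard_coe_eq_coe_finsetCard]
    exact Set.encard_le_encard fun l hl => h1 l hl
  · obtain ⟨S, hS, -, h2⟩ := key x
    rw [← hS, ← Set.encard_coe_eq_coe_finsetCard]
    exact Set.encard_le_encard fun l hl => h2 l hl.1 hl.2

lemma floor_sub_int_cast (y L : ℝ) (q : ℤ) : ⌊y - (L + q)⌋ = ⌊y - L⌋ - q := by
  rw [← sub_sub, Int.floor_sub_intCast]

-- The vertices lie on six vertical lines, with abscissas `s - 1 < -2 - s < s < -s < 2 + s < 1 - s`,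
-- which cut the decagon into a triangle, a trapezoid, a parallelogram of vertical height 2, a
-- trapezoid and a triangle. In a column the lattice points `n` are counted by the half-open
-- condition that `x 1 - n` is at least the lower and below the upper boundary; this count lies
-- between those for the interior and for the closed decagon. Upper edges on one side are integer
-- translates of lower edges on the other, so the floors cancel in the sum.
set_option maxHeartbeats 1000000 in
lemma isKFoldLatticeTile_stdDecagon {w : Plane} (hw : w ∈ interior quadW) :
    IsKFoldLatticeTile 5 (decagon (stdDecagon w)) := by
  have hpos := (isPosCycle_stdDecagon_iff w).2 hw
  rw [mem_interior_quadW_iff] at hw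
  obtain ⟨w1, w2, w3, w4⟩ := hw
  set v := stdDecagon w with hv
  set K := decagon v with hK
  have hconv : Convex ℝ K := convex_convexHull ℝ _
  have hvK : ∀ i, v i ∈ K := fun i => subset_convexHull ℝ _ ⟨i, rfl⟩
  obtain ⟨s, hs⟩ : ∃ s, s = w 0 := ⟨_, rfl⟩
  obtain ⟨t, ht⟩ : ∃ t, t = w 1 := ⟨_, rfl⟩
  have x0 : v 0 0 = s ∧ v 0 1 = t := by simp [hv, stdDecagon, hs, ht]
  have x1 : v 1 0 = -2 - s ∧ v 1 1 = 1 - t := by simp [hv, stdDecagon, hs, ht]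
  have x2 : v 2 0 = -1 + s ∧ v 2 1 = -1 + t := by simp [hv, stdDecagon, hs, ht]
  have x3 : v 3 0 = -2 - s ∧ v 3 1 = -t := by simp [hv, stdDecagon, hs, ht]
  have x4 : v 4 0 = s ∧ v 4 1 = -2 + t := by simp [hv, stdDecagon, hs, ht]
  have x5 : v 5 0 = -s ∧ v 5 1 = -t := by simp [hv, stdDecagon, hs, ht]
  have x6 : v 6 0 = 2 + s ∧ v 6 1 = -1 + t := by simp [hv, stdDecagon, hs, ht]
  have x7 : v 7 0 = 1 - s ∧ v 7 1 = 1 - t := by simp [hv, stdDecagon, hs, ht]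
  have x8 : v 8 0 = 2 + s ∧ v 8 1 = t := by simp [hv, stdDecagon, hs, ht]
  have x9 : v 9 0 = -s ∧ v 9 1 = 2 - t := by simp [hv, stdDecagon, hs, ht]
  rw [← hs] at w1
  rw [← hs, ← ht] at w2 w3 w4
  clear hs ht
  clear_value v
  obtain ⟨x0, y0⟩ := x0
  obtain ⟨x1, y1⟩ := x1
  obtain ⟨x2, y2⟩ := x2
  obtain ⟨x3, y3⟩ := x3
  obtain ⟨x4, y4⟩ := x4
  obtain ⟨x5, y5⟩ := x5
  obtain ⟨x6, y6⟩ := x6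
  obtain ⟨x7, y7⟩ := x7
  obtain ⟨x8, y8⟩ := x8
  obtain ⟨x9, y9⟩ := x9
  have hlower : ∀ i : Fin 10, v i 0 < v (i + 1) 0 → ∀ x ∈ interior K,
      lineAt (v i) (v (i + 1)) (x 0) < x 1 := by
    intro i hi x hx
    rw [hK, interior_decagon_of_isPosCycle hpos] at hx
    exact lineAt_lt_of_cross_pos hi (hx i)
  have hupper : ∀ i : Fin 10, v (i + 1) 0 < v i 0 → ∀ x ∈ interior K,
      x 1 < lineAt (v (i + 1)) (v i) (x 0) := by
    intro i hi x hx
    rw [hK, interior_decagon_of_isPosCycle hpos] at hx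
    exact lt_lineAt_of_cross_pos hi (hx i)
  have hbox : ∀ x ∈ K, -1 + s ≤ x 0 ∧ x 0 ≤ 1 - s := by
    intro x hx
    refine convexHull_min (t := {x : Plane | -1 + s ≤ x 0 ∧ x 0 ≤ 1 - s}) ?_ ?_ hx
    · rintro _ ⟨i, rfl⟩
      fin_cases i <;> constructor <;> simp <;> linarith
    · rintro x ⟨h1, h2⟩ y ⟨k1, k2⟩ a b ha hb hab
      obtain rfl : b = 1 - a := by linarith
      refine ⟨?_, ?_⟩ <;> simp only [PiLp.add_apply, PiLp.smul_apply, smul_eq_mul] <;> nlinarith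
  have hleft : ∀ x ∈ interior K, -1 + s < x 0 := by
    intro x hx
    have := cross_add_const_pos_of_mem_interior (a := !₂[0, -1]) (n := !₂[1, 0]) (c := 1 - s)
      (by simp [cross]) (fun y hy => by have := hbox y hy; simp [cross]; linarith) hx
    simp [cross] at this
    linarith
  have hright : ∀ x ∈ interior K, x 0 < 1 - s := by
    intro x hx
    have := cross_add_const_pos_of_mem_interior (a := !₂[0, 1]) (n := !₂[-1, 0]) (c := 1 - s)
      (by simp [cross]) (fun y hy => by have := hbox y hy; simp [cross]; linarith) hx
    simp [cross] at this
    linarith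
  have column : ∀ (x : Plane) (a b c d : Fin 10) (m n : ℤ), v a 0 = v c 0 → v b 0 = v d 0 →
      v a 0 < v b 0 → v a 0 ≤ x 0 - m → x 0 - m ≤ v b 0 →
      ⌊x 1 - lineAt (v c) (v d) (x 0 - m)⌋ < n → n ≤ ⌊x 1 - lineAt (v a) (v b) (x 0 - m)⌋ →
      x - !₂[(m : ℝ), (n : ℝ)] ∈ K := by
    intro x a b c d m n h1 h2 h3 h4 h5 h6 h7
    rw [Int.floor_lt] at h6
    rw [Int.le_floor] at h7
    refine mem_of_between_lines hconv (hvK a) (hvK b) (hvK c) (hvK d) h1 h2 h3 ?_ ?_ ?_ ?_ <;>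
      simp <;> linarith
  have column' : ∀ (x : Plane) (m n : ℤ), x - !₂[(m : ℝ), (n : ℝ)] ∈ interior K →
      ∀ (i j : Fin 10), v i 0 < v (i + 1) 0 → v (j + 1) 0 < v j 0 →
      ⌊x 1 - lineAt (v (j + 1)) (v j) (x 0 - m)⌋ < n ∧
        n ≤ ⌊x 1 - lineAt (v i) (v (i + 1)) (x 0 - m)⌋ := by
    intro x m n hx i j hi hj
    have h1 := hlower i hi _ hx
    have h2 := hupper j hj _ hx
    simp at h1 h2
    rw [Int.floor_lt, Int.le_floor]
    constructor <;> linarith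
  refine isKFoldLatticeTile_of_columns 5 s fun x hx0 hx1 => ?_
  -- Needed because the columns are counted with `Int.toNat`: the floor differences must be
  -- non-negative.
  have mono : ∀ (a b c d : Fin 10) (X : ℝ), v a 0 = v c 0 → v b 0 = v d 0 → v a 0 < v b 0 →
      v a 0 ≤ X → X ≤ v b 0 → v a 1 ≤ v c 1 → v b 1 ≤ v d 1 →
      ⌊x 1 - lineAt (v c) (v d) X⌋ ≤ ⌊x 1 - lineAt (v a) (v b) X⌋ := by
    intro a b c d X h1 h2 h3 h4 h5 h6 h7
    exact Int.floor_le_floor (sub_le_sub_left (lineAt_le_lineAt h1 h2 h3 h4 h5 h6 h7) _)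
  have middle : ∀ X, ⌊x 1 - lineAt (v 0) (v 9) X⌋ = ⌊x 1 - lineAt (v 4) (v 5) X⌋ - 2 := by
    intro X
    rw [lineAt_translate (a := v 4) (b := v 5) (X := X) (p := 0) (q := (2 : ℤ)), floor_sub_int_cast]
    all_goals push_cast; linarith
  rcases lt_or_ge (x 0) (-1 - s) with hx | hx
  -- Here the column meets the two triangles once each and the parallelogram twice; the triangles
  -- together contribute 1, so the total is 1 + 2 + 2.
  · have e1 : ⌊x 1 - lineAt (v 6) (v 7) (x 0 + 2)⌋ = ⌊x 1 - lineAt (v 2) (v 1) (x 0 - 1)⌋ - 0 := by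
      rw [lineAt_translate (a := v 2) (b := v 1) (X := x 0 - 1) (p := 3) (q := (0 : ℤ)),
        floor_sub_int_cast]
      all_goals push_cast; linarith
    have e2 : ⌊x 1 - lineAt (v 8) (v 7) (x 0 + 2)⌋ = ⌊x 1 - lineAt (v 2) (v 3) (x 0 - 1)⌋ - 1 := by
      rw [lineAt_translate (a := v 2) (b := v 3) (X := x 0 - 1) (p := 3) (q := (1 : ℤ)),
        floor_sub_int_cast]
      all_goals push_cast; linarith
    have m1 := mono 2 3 2 1 (x 0 - 1) rfl (by linarith) (by linarith) (by linarith) (by linarith)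
      (by linarith) (by linarith)
    have m2 := mono 6 7 8 7 (x 0 + 2) (by linarith) rfl (by linarith) (by linarith) (by linarith)
      (by linarith) (by linarith)
    refine ⟨{1, 0, -1, -2}, fun m =>
      if m = 1 then ⌊x 1 - lineAt (v 2) (v 1) (x 0 - m)⌋
      else if m = -2 then ⌊x 1 - lineAt (v 8) (v 7) (x 0 - m)⌋
      else ⌊x 1 - lineAt (v 0) (v 9) (x 0 - m)⌋, fun m =>
      if m = 1 then ⌊x 1 - lineAt (v 2) (v 3) (x 0 - m)⌋
      else if m = -2 then ⌊x 1 - lineAt (v 6) (v 7) (x 0 - m)⌋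
      else ⌊x 1 - lineAt (v 4) (v 5) (x 0 - m)⌋, ?_, ?_, ?_⟩
    · simp [middle]
      omega
    · intro m hm n h1 h2
      simp only [Finset.mem_insert, Finset.mem_singleton] at hm
      rcases hm with rfl | rfl | rfl | rfl
      · refine column x 2 3 2 1 1 n rfl ?_ ?_ ?_ ?_ (by simpa using h1) (by simpa using h2) <;>
          (try push_cast) <;> linarith
      · refine column x 4 5 0 9 0 n ?_ ?_ ?_ ?_ ?_ (by simpa using h1) (by simpa using h2) <;>
          (try push_cast) <;> linarith
      · refine column x 4 5 0 9 (-1) n ?_ ?_ ?_ ?_ ?_ (by simpa using h1) (by simpa using h2) <;>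
          (try push_cast) <;> linarith
      · refine column x 6 7 8 7 (-2) n ?_ rfl ?_ ?_ ?_ (by simpa using h1) (by simpa using h2) <;>
          (try push_cast) <;> linarith
    · intro m n hmn
      have hl := hleft _ hmn
      have hr := hright _ hmn
      simp at hl hr
      have hm1 : m < 2 := by
        have : (m : ℝ) < 2 := by linarith
        exact_mod_cast this
      have hm2 : -3 < m := by
        have : (-3 : ℝ) < m := by linarith
        exact_mod_cast this
      have c1 := column' x m n hmn 2 1 (show v 2 0 < v 3 0 by linarith)
        (show v 2 0 < v 1 0 by linarith)
      have c2 := column' x m n hmn 4 9 (show v 4 0 < v 5 0 by linarith)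
        (show v 0 0 < v 9 0 by linarith)
      have c3 := column' x m n hmn 6 7 (show v 6 0 < v 7 0 by linarith)
        (show v 8 0 < v 7 0 by linarith)
      refine ⟨by simp; omega, ?_⟩
      beta_reduce
      split_ifs
      exacts [c1, c3, c2]
  -- Here it meets both trapezoids and the parallelogram once; the trapezoids together contribute 3,
  -- so the total is 3 + 2.
  · have e1 : ⌊x 1 - lineAt (v 1) (v 0) (x 0 - 1)⌋ = ⌊x 1 - lineAt (v 5) (v 6) (x 0 + 1)⌋ - 1 := by
      rw [lineAt_translate (a := v 5) (b := v 6) (X := x 0 + 1) (p := -2) (q := (1 : ℤ)),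
        floor_sub_int_cast]
      all_goals push_cast; linarith
    have e2 : ⌊x 1 - lineAt (v 9) (v 8) (x 0 + 1)⌋ = ⌊x 1 - lineAt (v 3) (v 4) (x 0 - 1)⌋ - 2 := by
      rw [lineAt_translate (a := v 3) (b := v 4) (X := x 0 - 1) (p := 2) (q := (2 : ℤ)),
        floor_sub_int_cast]
      all_goals push_cast; linarith
    have m1 := mono 3 4 1 0 (x 0 - 1) (by linarith) (by linarith) (by linarith) (by linarith)
      (by linarith) (by linarith) (by linarith)
    have m2 := mono 5 6 9 8 (x 0 + 1) (by linarith) (by linarith) (by linarith) (by linarith)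
      (by linarith) (by linarith) (by linarith)
    refine ⟨{1, 0, -1}, fun m =>
      if m = 1 then ⌊x 1 - lineAt (v 1) (v 0) (x 0 - m)⌋
      else if m = -1 then ⌊x 1 - lineAt (v 9) (v 8) (x 0 - m)⌋
      else ⌊x 1 - lineAt (v 0) (v 9) (x 0 - m)⌋, fun m =>
      if m = 1 then ⌊x 1 - lineAt (v 3) (v 4) (x 0 - m)⌋
      else if m = -1 then ⌊x 1 - lineAt (v 5) (v 6) (x 0 - m)⌋
      else ⌊x 1 - lineAt (v 4) (v 5) (x 0 - m)⌋, ?_, ?_, ?_⟩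
    · simp [middle]
      omega
    · intro m hm n h1 h2
      simp only [Finset.mem_insert, Finset.mem_singleton] at hm
      rcases hm with rfl | rfl | rfl
      · refine column x 3 4 1 0 1 n ?_ ?_ ?_ ?_ ?_ (by simpa using h1) (by simpa using h2) <;>
          (try push_cast) <;> linarith
      · refine column x 4 5 0 9 0 n ?_ ?_ ?_ ?_ ?_ (by simpa using h1) (by simpa using h2) <;>
          (try push_cast) <;> linarith
      · refine column x 5 6 9 8 (-1) n ?_ ?_ ?_ ?_ ?_ (by simpa using h1) (by simpa using h2) <;>
          (try push_cast) <;> linarith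
    · intro m n hmn
      have hl := hleft _ hmn
      have hr := hright _ hmn
      simp at hl hr
      have hm1 : m < 2 := by
        have : (m : ℝ) < 2 := by linarith
        exact_mod_cast this
      have hm2 : -2 < m := by
        have : (-2 : ℝ) < m := by linarith
        exact_mod_cast this
      have c1 := column' x m n hmn 3 0 (show v 3 0 < v 4 0 by linarith)
        (show v 1 0 < v 0 0 by linarith)
      have c2 := column' x m n hmn 4 9 (show v 4 0 < v 5 0 by linarith)
        (show v 0 0 < v 9 0 by linarith)
      have c3 := column' x m n hmn 5 8 (show v 5 0 < v 6 0 by linarith)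
        (show v 9 0 < v 8 0 by linarith)
      refine ⟨by simp; omega, ?_⟩
      beta_reduce
      split_ifs
      exacts [c1, c3, c2]

/-! ### Affine invariance and reduction to the integer lattice. -/

lemma IsKFoldTiling.image {k : ℕ} {K : Set Plane} {Λ Λ' : Submodule ℤ Plane}
    (h : IsKFoldTiling k K Λ) (σ : Plane ≃ᵃ[ℝ] Plane) (hΛ : ∀ l, σ.linear l ∈ Λ' ↔ l ∈ Λ) :
    IsKFoldTiling k (σ '' K) Λ' := by
  have key : ∀ (S : Set Plane) (x : Plane), {l | l ∈ Λ' ∧ x - l ∈ σ '' S}.encard =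
      {l | l ∈ Λ ∧ σ.symm x - l ∈ S}.encard := by
    intro S x
    rw [← σ.linear.injective.encard_image {l | l ∈ Λ ∧ σ.symm x - l ∈ S}]
    congr 1
    have e : ∀ l, σ (σ.symm x - l) = x - σ.linear l := by
      intro l
      have := σ.map_vadd (σ.symm x) (-l)
      rw [vadd_eq_add, vadd_eq_add, neg_add_eq_sub, σ.apply_symm_apply, map_neg] at this
      rw [this, neg_add_eq_sub]
    ext l
    constructor
    · rintro ⟨hl, hx⟩
      obtain ⟨m, rfl⟩ := σ.linear.surjective l
      refine ⟨m, ⟨(hΛ m).1 hl, ?_⟩, rfl⟩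
      rwa [← e, σ.injective.mem_set_image] at hx
    · rintro ⟨m, ⟨hm, hx⟩, rfl⟩
      exact ⟨(hΛ m).2 hm, e m ▸ Set.mem_image_of_mem σ hx⟩
  have hint : interior (σ '' K) = σ '' interior K :=
    (σ.toContinuousAffineEquiv.toHomeomorph.image_interior K).symm
  refine ⟨fun x => ?_, fun x => ?_⟩
  · rw [key]; exact h.1 _
  · rw [hint, key]; exact h.2 _

lemma IsKFoldLatticeTile.of_image {k : ℕ} {K : Set Plane} (σ : Plane ≃ᵃ[ℝ] Plane)
    (h : IsKFoldLatticeTile k (σ '' K)) : IsKFoldLatticeTile k K := by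
  obtain ⟨Λ, hd, hz, ht⟩ := h
  let e : Plane ≃L[ℝ] Plane := σ.linear.toContinuousLinearEquiv
  refine ⟨ZLattice.comap ℝ Λ e.toLinearMap, inferInstance, inferInstance, ?_⟩
  have := ht.image σ.symm (Λ' := ZLattice.comap ℝ Λ e.toLinearMap) fun l => ?_
  · rwa [← Set.image_comp, ← AffineEquiv.coe_trans, AffineEquiv.self_trans_symm,
      AffineEquiv.coe_refl, Set.image_id] at this
  · show σ.linear (σ.linear.symm l) ∈ Λ ↔ l ∈ Λ
    rw [LinearEquiv.apply_symm_apply]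

lemma exists_cross_map (f : Plane →ₗ[ℝ] Plane) :
    ∃ δ : ℝ, ∀ x y, cross (f x) (f y) = δ * cross x y := by
  have e : ∀ x : Plane, x = x 0 • !₂[1, 0] + x 1 • !₂[0, 1] := by
    intro x; apply plane_ext <;> simp
  refine ⟨cross (f !₂[1, 0]) (f !₂[0, 1]), fun x y => ?_⟩
  rw [e x, e y]
  simp only [map_add, map_smul, cross_add_left, cross_add_right, cross_smul_left,
    cross_smul_right, cross_same]
  rw [cross_swap (f !₂[0, 1]) (f !₂[1, 0])]
  simp [cross]
  ring

lemma exists_cross_map_ne_zero (f : Plane ≃ₗ[ℝ] Plane) :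
    ∃ δ : ℝ, δ ≠ 0 ∧ ∀ x y, cross (f x) (f y) = δ * cross x y := by
  obtain ⟨δ, h⟩ := exists_cross_map f.toLinearMap
  refine ⟨δ, ?_, h⟩
  rintro rfl
  have := h (f.symm !₂[1, 0]) (f.symm !₂[0, 1])
  simp [cross] at this

lemma IsDecagonCycle.map {p : Fin 10 → Plane} (h : IsDecagonCycle p) (σ : Plane ≃ᵃ[ℝ] Plane) :
    IsDecagonCycle (σ ∘ p) := by
  obtain ⟨δ, hδ, hc⟩ := exists_cross_map_ne_zero σ.linear
  have e : ∀ i j k : Fin 10, cross ((σ ∘ p) j - (σ ∘ p) i) ((σ ∘ p) k - (σ ∘ p) i) =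
      δ * cross (p j - p i) (p k - p i) := by
    intro i j k
    have l : ∀ a b : Plane, σ a - σ b = σ.linear (a - b) := fun a b =>
      (σ.toAffineMap.linearMap_vsub a b).symm
    simp only [Function.comp, l, hc]
  simp only [IsDecagonCycle, e]
  rcases hδ.lt_or_gt with h0 | h0 <;> rcases h with h | h
  · exact Or.inr fun i j hi hj => mul_neg_of_neg_of_pos h0 (h i j hi hj)
  · exact Or.inl fun i j hi hj => mul_pos_of_neg_of_neg h0 (h i j hi hj)
  · exact Or.inl fun i j hi hj => mul_pos h0 (h i j hi hj)
  · exact Or.inr fun i j hi hj => mul_neg_of_pos_of_neg h0 (h i j hi hj)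

lemma decagon_map (p : Fin 10 → Plane) (σ : Plane ≃ᵃ[ℝ] Plane) :
    decagon (σ ∘ p) = σ '' decagon p := by
  unfold decagon
  rw [Set.range_comp]
  exact (σ.toAffineMap.image_convexHull (Set.range p)).symm

/-- A lattice tile is, up to a linear map, a tile for the integer lattice. -/
lemma IsKFoldLatticeTile.exists_intLattice {k : ℕ} {K : Set Plane} (h : IsKFoldLatticeTile k K) :
    ∃ σ : Plane ≃ᵃ[ℝ] Plane, IsKFoldTiling k (σ '' K) intLattice := by
  obtain ⟨Λ, hd, hz, ht⟩ := h
  have hcard : Fintype.card (Module.Free.ChooseBasisIndex ℤ Λ) = 2 := by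
    rw [← Module.finrank_eq_card_chooseBasisIndex, ZLattice.rank ℝ Λ]
    simp
  let b : Module.Basis (Fin 2) ℤ Λ :=
    (Module.Free.chooseBasis ℤ Λ).reindex (Fintype.equivFinOfCardEq hcard)
  let B := b.ofZLatticeBasis ℝ Λ
  let C := (EuclideanSpace.basisFun (Fin 2) ℝ).toBasis
  let T : Plane ≃ₗ[ℝ] Plane := B.equiv C (Equiv.refl _)
  refine ⟨T.toAffineEquiv, ht.image _ fun l => ?_⟩
  show T l ∈ intLattice ↔ l ∈ Λ
  have e : ∀ i, C.repr (T l) i = B.repr l i := by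
    intro i
    simp [T, Module.Basis.equiv]
  rw [intLattice, Module.Basis.mem_span_iff_repr_mem, ← b.ofZLatticeBasis_span ℝ,
    Module.Basis.mem_span_iff_repr_mem]
  exact forall_congr' fun i => by rw [← e]

/-! ### Comparing translates of two intervals by a cyclic group. -/

section FloorCounting

/-- The left side counts the integers in the half-open interval from `u - L` to `u`: an arc of
length `L` covers each point of the circle `⌊L⌋` times, and those of an arc of length `Int.fract L`
once more. -/
lemma floor_sub_floor_sub (u L : ℝ) :
    ⌊u⌋ - ⌊u - L⌋ = ⌊L⌋ + if Int.fract u < Int.fract L then 1 else 0 := by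
  have hu := Int.floor_add_fract u
  have hL := Int.floor_add_fract L
  have u0 := Int.fract_nonneg u
  have u1 := Int.fract_lt_one u
  have L0 := Int.fract_nonneg L
  have L1 := Int.fract_lt_one L
  split_ifs with h
  · have : ⌊u - L⌋ = ⌊u⌋ - ⌊L⌋ - 1 := by
      rw [Int.floor_eq_iff]; push_cast; constructor <;> linarith
    omega
  · have : ⌊u - L⌋ = ⌊u⌋ - ⌊L⌋ := by
      rw [Int.floor_eq_iff]; push_cast; constructor <;> linarith
    omega

/-- Two arcs on a circle covering every point equally often have the same length, and the same
position unless they wind round the circle a whole number of times. -/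
lemma eq_of_floor_sub_eq {L R γ : ℝ}
    (h : ∀ u : ℝ, ⌊u⌋ - ⌊u - L⌋ = ⌊u + γ⌋ - ⌊u + γ - R⌋) :
    L = R ∧ ((∃ n : ℤ, γ = n) ∨ ∃ n : ℤ, L = n) := by
  simp only [floor_sub_floor_sub] at h
  have hL := Int.floor_add_fract L
  have hR := Int.floor_add_fract R
  have hγ := Int.floor_add_fract γ
  have L0 := Int.fract_nonneg L
  have L1 := Int.fract_lt_one L
  have R0 := Int.fract_nonneg R
  have R1 := Int.fract_lt_one R
  have g0 := Int.fract_nonneg γ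
  have g1 := Int.fract_lt_one γ
  set l := Int.fract L
  set r := Int.fract R
  set g := Int.fract γ
  have fr : ∀ u : ℝ, 0 ≤ u → u < 1 → Int.fract u = u := fun u h0 h1 => Int.fract_eq_self.2 ⟨h0, h1⟩
  have shift : ∀ u : ℝ, Int.fract (u - g + γ) = Int.fract u := by
    intro u
    rw [← hγ, show u - g + (⌊γ⌋ + g) = u + (⌊γ⌋ : ℝ) by ring, Int.fract_add_intCast]
  -- At `u = l` the left indicator vanishes, at `u = r - g` the right one; this gives both
  -- inequalities between the integer parts.
  have hfl : ⌊L⌋ = ⌊R⌋ := by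
    have h1 := h l
    have h2 := h (r - g)
    rw [fr l L0 L1, if_neg (lt_irrefl _)] at h1
    rw [shift, fr r R0 R1, if_neg (lt_irrefl _)] at h2
    split_ifs at h1 h2 <;> omega
  have hiff : ∀ u : ℝ, Int.fract u < l ↔ Int.fract (u + γ) < r := by
    intro u
    have := h u
    split_ifs at this <;> first | omega | tauto
  have hiff' : ∀ u : ℝ, Int.fract (u - g) < l ↔ Int.fract u < r := by
    intro u
    rw [hiff, shift]
  have hg0 : Int.fract (0 + γ) = g := by rw [zero_add]
  rcases L0.eq_or_lt with l0 | l0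
  · have r0 : r = 0 := by
      by_contra hne
      have := (hiff' 0).2 (by rw [fr 0 le_rfl one_pos]; exact lt_of_le_of_ne R0 (Ne.symm hne))
      have h0 := Int.fract_nonneg (0 - g)
      linarith
    exact ⟨by rw [← hL, ← hR, hfl, r0, ← l0], Or.inr ⟨⌊L⌋, by linarith⟩⟩
  · have h1 : g < r := by
      have := (hiff 0).1 (by rw [fr 0 le_rfl one_pos]; exact l0)
      rwa [hg0] at this
    rcases g0.eq_or_lt with e0 | e0
    · have h2 := hiff' l
      have h3 := hiff' r
      rw [← e0, sub_zero, fr l L0 L1] at h2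
      rw [← e0, sub_zero, fr r R0 R1] at h3
      have : l = r := le_antisymm (not_lt.1 fun h => lt_irrefl _ (h3.1 h))
        (not_lt.1 fun h => lt_irrefl _ (h2.2 h))
      exact ⟨by rw [← hL, ← hR, hfl, this], Or.inl ⟨⌊γ⌋, by linarith⟩⟩
    -- If `0 < g`, testing at 1 and at `r` yields `1 - g < l ≤ r - g`, impossible since `r < 1`.
    · exfalso
      have h2 := (hiff' 1).2 (by rw [Int.fract_one]; linarith)
      rw [fr (1 - g) (by linarith) (by linarith)] at h2
      have h3 := hiff' r
      rw [fr r R0 R1, fr (r - g) (by linarith) (by linarith)] at h3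
      have h4 : ¬ (r - g < l) := fun h => lt_irrefl _ (h3.1 h)
      linarith

lemma exists_notMem_of_countable {B : Set ℝ} (hB : B.Countable) {a b : ℝ} (hab : a < b) :
    ∃ t, a < t ∧ t < b ∧ t ∉ B := by
  obtain ⟨t, ht, ht'⟩ := (hB.dense_compl ℝ).exists_mem_open isOpen_Ioo (Set.nonempty_Ioo.2 hab)
  exact ⟨t, ht'.1, ht'.2, ht⟩

/-- Right continuity of the floor extends identities from the complement of a countable set to every
point. -/
lemma exists_floor_add_eq (a : ℝ) : ∃ δ > 0, ∀ h, 0 ≤ h → h < δ → ⌊a + h⌋ = ⌊a⌋ := by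
  refine ⟨⌊a⌋ + 1 - a, by linarith [Int.lt_floor_add_one a], fun h h0 h1 => ?_⟩
  rw [Int.floor_eq_iff]
  constructor <;> linarith [Int.floor_le a]

/-- The hypothesis `ht` keeps the left end of the closed interval off the group, so that the
half-open count by floors is exact. -/
lemma encard_zmultiples_inter {p t r : ℝ} (hp : 0 < p)
    (ht : ∀ n : ℤ, t - r ≠ n * p) :
    {s : ℝ | s ∈ AddSubgroup.zmultiples p ∧ 0 ≤ t - s ∧ t - s ≤ r}.encard =
      ((⌊t / p⌋ - ⌊t / p - r / p⌋).toNat : ℕ∞) := by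
  have hinj : Function.Injective fun n : ℤ => (n : ℝ) * p := by
    intro m n e
    exact_mod_cast mul_right_cancel₀ hp.ne' e
  have e : {s : ℝ | s ∈ AddSubgroup.zmultiples p ∧ 0 ≤ t - s ∧ t - s ≤ r} =
      (fun n : ℤ => (n : ℝ) * p) '' (Finset.Ioc ⌊t / p - r / p⌋ ⌊t / p⌋ : Finset ℤ) := by
    ext s
    simp only [Set.mem_ofPred_eq, AddSubgroup.mem_zmultiples_iff, Set.mem_image, Finset.mem_coe,
      Finset.mem_Ioc, zsmul_eq_mul]
    have key : ∀ n : ℤ, (0 ≤ t - n * p ∧ t - n * p ≤ r) ↔ (⌊t / p - r / p⌋ < n ∧ n ≤ ⌊t / p⌋) := by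
      intro n
      rw [Int.floor_lt, Int.le_floor, ← sub_div, div_lt_iff₀ hp, le_div_iff₀ hp]
      constructor
      · rintro ⟨h1, h2⟩
        exact ⟨lt_of_le_of_ne (by linarith) (ht n), by linarith⟩
      · rintro ⟨h1, h2⟩
        constructor <;> linarith
    constructor
    · rintro ⟨⟨n, rfl⟩, h⟩
      exact ⟨n, (key n).1 h, rfl⟩
    · rintro ⟨n, h, rfl⟩
      exact ⟨⟨n, rfl⟩, (key n).2 h⟩
  rw [e, hinj.encard_image, Set.encard_coe_eq_coe_finsetCard, Int.card_Ioc]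

lemma countable_setOf_exists_int (f : ℤ → ℝ) : {t : ℝ | ∃ n, t = f n}.Countable := by
  have : {t : ℝ | ∃ n, t = f n} = Set.range f := by ext t; simp [eq_comm]
  rw [this]
  exact Set.countable_range f

/-- If the translates of two intervals by a cyclic subgroup cover almost every point equally often,
then the intervals are equally long, and translates of each other unless they are unions of
periods. -/
lemma eq_one_of_encard_eq {p c r : ℝ} (hr : 0 < r) {B : Set ℝ} (hB : B.Countable)
    (h : ∀ t ∉ B, {s : ℝ | s ∈ AddSubgroup.zmultiples p ∧ 0 ≤ t - s ∧ t - s ≤ 1}.encard =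
      {s : ℝ | s ∈ AddSubgroup.zmultiples p ∧ 0 ≤ t + c - s ∧ t + c - s ≤ r}.encard) :
    r = 1 ∧ (c ∈ AddSubgroup.zmultiples p ∨ (1 : ℝ) ∈ AddSubgroup.zmultiples p) := by
  wlog hp : 0 ≤ p generalizing p
  · have := @this (-p) (by simpa only [AddSubgroup.zmultiples_neg] using h) (by linarith)
    simpa only [AddSubgroup.zmultiples_neg] using this
  rcases hp.eq_or_lt with rfl | hp
  · simp only [AddSubgroup.zmultiples_zero_eq_bot, AddSubgroup.mem_bot] at h ⊢
    have h' : ∀ t ∉ B, (0 ≤ t ∧ t ≤ 1) ↔ (0 ≤ t + c ∧ t + c ≤ r) := by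
      intro t ht
      have key : ∀ a b : ℝ, {s : ℝ | s = 0 ∧ 0 ≤ a - s ∧ a - s ≤ b} =
          if 0 ≤ a ∧ a ≤ b then {0} else ∅ := by
        intro a b
        split_ifs with hab
        · ext s
          simp only [Set.mem_ofPred_eq, Set.mem_singleton_iff]
          exact ⟨fun h => h.1, by rintro rfl; simpa using hab⟩
        · ext s
          simp only [Set.mem_ofPred_eq, Set.mem_empty_iff_false, iff_false]
          rintro ⟨rfl, h⟩
          exact hab (by simpa using h)
      have := h t ht
      rw [key, key] at this
      split_ifs at this with q1 q2 q2
      · exact ⟨fun _ => q2, fun _ => q1⟩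
      · simp at this
      · simp at this
      · exact ⟨fun h => absurd h q1, fun h => absurd h q2⟩
    have a1 : 0 ≤ c := by
      by_contra! hc
      obtain ⟨t, t1, t2, tB⟩ := exists_notMem_of_countable hB (show 0 < min 1 (-c) by simp [hc])
      have := (h' t tB).1 ⟨t1.le, t2.le.trans (min_le_left _ _)⟩
      have := t2.trans_le (min_le_right 1 (-c))
      linarith
    have a2 : 1 + c ≤ r := by
      by_contra! hc
      obtain ⟨t, t1, t2, tB⟩ := exists_notMem_of_countable hB (show max 0 (r - c) < 1 by
        simp; linarith)
      have := (h' t tB).1 ⟨(le_max_left _ _).trans t1.le, t2.le⟩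
      have := (le_max_right 0 (r - c)).trans_lt t1
      linarith
    have a3 : c ≤ 0 := by
      by_contra! hc
      obtain ⟨t, t1, t2, tB⟩ := exists_notMem_of_countable hB (show -c < min 0 (r - c) by
        simp; exact ⟨by linarith, by linarith⟩)
      have := t2.trans_le (min_le_left 0 (r - c))
      have h2 := t2.trans_le (min_le_right 0 (r - c))
      have := (h' t tB).2 ⟨by linarith, by linarith⟩
      linarith
    have a4 : r - c ≤ 1 := by
      by_contra! hc
      obtain ⟨t, t1, t2, tB⟩ := exists_notMem_of_countable hB (show max (-c) 1 < r - c by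
        simp; exact ⟨by linarith, by linarith⟩)
      have := (le_max_left (-c) 1).trans_lt t1
      have h2 := (le_max_right (-c) 1).trans_lt t1
      have := (h' t tB).2 ⟨by linarith, by linarith⟩
      linarith
    exact ⟨by linarith, Or.inl (by linarith)⟩
  -- After division by `p` the group becomes the integers. A good `t` slightly to the right of `u *
  -- p` avoids `B` and all interval ends without changing any of the four floors.
  · have key : ∀ u : ℝ, ⌊u⌋ - ⌊u - 1 / p⌋ = ⌊u + c / p⌋ - ⌊u + c / p - r / p⌋ := by
      intro u
      obtain ⟨δ1, d1, k1⟩ := exists_floor_add_eq u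
      obtain ⟨δ2, d2, k2⟩ := exists_floor_add_eq (u - 1 / p)
      obtain ⟨δ3, d3, k3⟩ := exists_floor_add_eq (u + c / p)
      obtain ⟨δ4, d4, k4⟩ := exists_floor_add_eq (u + c / p - r / p)
      have hB' : (B ∪ {t : ℝ | ∃ n : ℤ, t = 1 + n * p} ∪
          {t : ℝ | ∃ n : ℤ, t = r - c + n * p}).Countable :=
        (hB.union (countable_setOf_exists_int _)).union (countable_setOf_exists_int _)
      have hδ : 0 < min (min δ1 δ2) (min δ3 δ4) :=
        lt_min (lt_min d1 d2) (lt_min d3 d4)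
      obtain ⟨t, t1, t2, tB⟩ := exists_notMem_of_countable hB'
        (show u * p < u * p + min (min δ1 δ2) (min δ3 δ4) * p by
          linarith [mul_pos hδ hp])
      simp only [Set.mem_union, Set.mem_ofPred_eq, not_or, not_exists] at tB
      obtain ⟨⟨tB1, tB2⟩, tB3⟩ := tB
      set e := t / p - u with he
      have htp : t / p = u + e := by rw [he]; ring
      have e0 : 0 ≤ e := by
        rw [he, sub_nonneg, le_div_iff₀ hp]; exact t1.le
      have e1 : e < min (min δ1 δ2) (min δ3 δ4) := by
        rw [he, sub_lt_iff_lt_add', div_lt_iff₀ hp, add_mul]; exact t2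
      obtain ⟨⟨g1, g2⟩, ⟨g3, g4⟩⟩ : (e < δ1 ∧ e < δ2) ∧ (e < δ3 ∧ e < δ4) := by
        simpa only [lt_min_iff] using e1
      have := h t tB1
      rw [encard_zmultiples_inter hp (fun n hn => tB2 n (by linarith)),
        encard_zmultiples_inter hp (fun n hn => tB3 n (by linarith))] at this
      rw [add_div, htp, show u + e - 1 / p = u - 1 / p + e by ring,
        show u + e + c / p - r / p = u + c / p - r / p + e by ring,
        show u + e + c / p = u + c / p + e by ring, k1 e e0 g1, k2 e e0 g2, k3 e e0 g3,
        k4 e e0 g4] at this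
      have this : (⌊u⌋ - ⌊u - 1 / p⌋).toNat = (⌊u + c / p⌋ - ⌊u + c / p - r / p⌋).toNat := by
        exact_mod_cast this
      have m1 : ⌊u - 1 / p⌋ ≤ ⌊u⌋ := Int.floor_le_floor (by
        have : 0 < 1 / p := by positivity
        linarith)
      have m2 : ⌊u + c / p - r / p⌋ ≤ ⌊u + c / p⌋ := Int.floor_le_floor (by
        have : 0 < r / p := by positivity
        linarith)
      omega
    obtain ⟨h1, h2⟩ := eq_of_floor_sub_eq key
    refine ⟨?_, ?_⟩
    · field_simp at h1
      exact h1.symm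
    · simp only [AddSubgroup.mem_zmultiples_iff, zsmul_eq_mul]
      rcases h2 with ⟨n, hn⟩ | ⟨n, hn⟩
      · exact Or.inl ⟨n, by rw [← hn]; field_simp⟩
      · exact Or.inr ⟨n, by rw [← hn]; field_simp⟩

end FloorCounting

/-! ### Opposite edges in a lattice tiling. -/

lemma IsPosCycle.cross_edge_succ {v : Fin 10 → Plane} (h : IsPosCycle v) (i : Fin 10) :
    0 < cross (v (i + 1) - v i) (v (i + 1 + 1) - v (i + 1)) := by
  have := h i (i + 1 + 1) (by rw [add_assoc]; simp) (by simp)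
  have e : cross (v (i + 1) - v i) (v (i + 1 + 1) - v (i + 1)) =
      cross (v (i + 1) - v i) (v (i + 1 + 1) - v i) := by
    simp only [cross, PiLp.sub_apply]; ring
  rwa [e]

/-- Distinct parallel edges of a convex polygon have opposite directions. -/
lemma IsPosCycle.exists_neg_smul_of_cross_eq_zero {v : Fin 10 → Plane} (h : IsPosCycle v)
    {i j : Fin 10} (hij : j ≠ i) (h0 : cross (v (i + 1) - v i) (v (j + 1) - v j) = 0) :
    ∃ r : ℝ, 0 < r ∧ v (j + 1) - v j = -(r • (v (i + 1) - v i)) := by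
  obtain ⟨r, hr⟩ := exists_smul_of_cross_eq_zero (h.edge_ne_zero i) h0
  have hji : j ≠ i + 1 := by
    rintro rfl
    exact (h.cross_edge_succ i).ne' h0
  have hij' : i ≠ j + 1 := by
    rintro rfl
    have := h.cross_edge_succ j
    rw [cross_swap, h0] at this
    simp at this
  have h1 := h i j hij hji
  have h2 := h j i hij.symm hij'
  rw [hr, cross_smul_left] at h2
  have h3 : cross (v (i + 1) - v i) (v i - v j) = -cross (v (i + 1) - v i) (v j - v i) := by
    simp only [cross, PiLp.sub_apply]; ring
  rw [h3] at h2
  refine ⟨-r, ?_, by rw [hr, neg_smul, neg_neg]⟩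
  by_contra! hr0
  nlinarith

/-- The points of an edge. -/
lemma IsPosCycle.mem_edge_iff {v : Fin 10 → Plane} (h : IsPosCycle v) (i : Fin 10) (y : Plane) :
    (y ∈ decagon v ∧ edgeForm v i y = 0) ↔
      ∃ τ : ℝ, 0 ≤ τ ∧ τ ≤ 1 ∧ y = v i + τ • (v (i + 1) - v i) := by
  constructor
  · rintro ⟨hy, h0⟩
    obtain ⟨τ, hτ⟩ := exists_smul_of_cross_eq_zero (h.edge_ne_zero i) h0
    have hy' : y = v i + τ • (v (i + 1) - v i) := by rw [← hτ]; abel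
    rw [decagon_eq_of_isPosCycle h] at hy
    refine ⟨τ, ?_, ?_, hy'⟩
    · have h1 := hy (i - 1)
      have h2 := h.cross_edge_succ (i - 1)
      simp only [edgeForm, sub_add_cancel] at h1 h2
      have e : cross (v i - v (i - 1)) (y - v (i - 1)) =
          τ * cross (v i - v (i - 1)) (v (i + 1) - v i) := by
        rw [hy']; simp only [cross, PiLp.sub_apply, PiLp.add_apply, PiLp.smul_apply, smul_eq_mul]
        ring
      rw [e] at h1
      exact nonneg_of_mul_nonneg_left h1 h2
    · have h1 := hy (i + 1)
      have h2 := h.cross_edge_succ i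
      simp only [edgeForm] at h1
      have e : cross (v (i + 1 + 1) - v (i + 1)) (y - v (i + 1)) =
          (1 - τ) * cross (v (i + 1) - v i) (v (i + 1 + 1) - v (i + 1)) := by
        rw [hy']; simp only [cross, PiLp.sub_apply, PiLp.add_apply, PiLp.smul_apply, smul_eq_mul]
        ring
      rw [e] at h1
      linarith [nonneg_of_mul_nonneg_left h1 h2]
  · rintro ⟨τ, h0, h1, rfl⟩
    refine ⟨?_, ?_⟩
    · have hmem : ∀ j, v j ∈ decagon v := fun j => subset_convexHull ℝ _ ⟨j, rfl⟩
      have hconv : Convex ℝ (decagon v) := convex_convexHull ℝ _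
      have := hconv (hmem i) (hmem (i + 1)) (a := 1 - τ) (b := τ) (by linarith) h0 (by ring)
      convert this using 1
      module
    · simp [edgeForm, cross_smul_right, cross_same]

lemma isBounded_decagon (v : Fin 10 → Plane) : Bornology.IsBounded (decagon v) :=
  isBounded_convexHull.2 (Set.finite_range v).isBounded

lemma finite_intLattice_inter {s : Set Plane} (hs : Bornology.IsBounded s) :
    {l | l ∈ intLattice ∧ l ∈ s}.Finite := by
  have := ZSpan.setFinite_inter (EuclideanSpace.basisFun (Fin 2) ℝ).toBasis hs
  exact this.subset fun l hl => ⟨hl.2, hl.1⟩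

lemma edgeForm_add_smul_sub (v : Fin 10 → Plane) (i : Fin 10) (x n l : Plane) (ε : ℝ) :
    edgeForm v i (x + ε • n - l) = edgeForm v i (x - l) + ε * cross (v (i + 1) - v i) n := by
  rw [show x + ε • n - l = x - l + ε • n by abel, edgeForm_add, cross_smul_right]

/-- Pushing a point off the boundaries of all translates, in a direction which is not tangent to any
of them, leads to a point covered exactly `k` times. -/
lemma IsKFoldTiling.encard_pushed {k : ℕ} {v : Fin 10 → Plane} (hv : IsPosCycle v)
    (ht : IsKFoldTiling k (decagon v) intLattice) (x n : Plane)
    (hn : ∀ l ∈ intLattice, x - l ∈ decagon v → ∀ j, edgeForm v j (x - l) = 0 →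
      cross (v (j + 1) - v j) n ≠ 0) :
    {l | l ∈ intLattice ∧ x - l ∈ decagon v ∧
      ∀ j, edgeForm v j (x - l) = 0 → 0 < cross (v (j + 1) - v j) n}.encard = k := by
  set G := {l | l ∈ intLattice ∧ x - l ∈ decagon v ∧
      ∀ j, edgeForm v j (x - l) = 0 → 0 < cross (v (j + 1) - v j) n}
  have hD := decagon_eq_of_isPosCycle hv
  have hI := interior_decagon_of_isPosCycle hv
  obtain ⟨ρ, hρ⟩ := (isBounded_decagon v).subset_closedBall x
  obtain ⟨ρ, hρ'⟩ := (isBounded_decagon v).subset_closedBall 0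
  -- Only these finitely many lattice vectors matter for pushes with `ε ≤ 1`, so a single small `ε`
  -- serves them all.
  let S := {l | l ∈ intLattice ∧ l ∈ Metric.closedBall x (ρ + ‖n‖)}
  have hSfin : S.Finite := finite_intLattice_inter Metric.isBounded_closedBall
  have hS : ∀ ε : ℝ, 0 ≤ ε → ε ≤ 1 → ∀ l ∈ intLattice, x + ε • n - l ∈ decagon v → l ∈ S := by
    intro ε h0 h1 l hl hx
    refine ⟨hl, ?_⟩
    have h2 := hρ' hx
    rw [mem_closedBall_zero_iff] at h2
    rw [Metric.mem_closedBall, dist_comm, dist_eq_norm]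
    calc ‖x - l‖ = ‖(x + ε • n - l) - ε • n‖ := by congr 1; abel
      _ ≤ ‖x + ε • n - l‖ + ‖ε • n‖ := norm_sub_le _ _
      _ ≤ ρ + ‖n‖ := by
        rw [norm_smul, Real.norm_of_nonneg h0]
        have := mul_le_mul_of_nonneg_right h1 (norm_nonneg n)
        linarith
  have hcont : ∀ l j, Filter.Tendsto (fun ε : ℝ => edgeForm v j (x + ε • n - l))
      (nhdsWithin 0 (Set.Ioi 0)) (nhds (edgeForm v j (x - l))) := by
    intro l j
    have : Continuous fun ε : ℝ => edgeForm v j (x + ε • n - l) :=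
      (continuous_edgeForm v j).comp (by fun_prop)
    simpa using (this.tendsto 0).mono_left nhdsWithin_le_nhds
  have hpos : ∀ᶠ ε : ℝ in nhdsWithin 0 (Set.Ioi 0), 0 < ε := self_mem_nhdsWithin
  have hle : ∀ᶠ ε : ℝ in nhdsWithin 0 (Set.Ioi 0), ε < 1 :=
    nhdsWithin_le_nhds (Iio_mem_nhds one_pos)
  have hout : ∀ l ∈ S, ∀ᶠ ε : ℝ in nhdsWithin 0 (Set.Ioi 0),
      x + ε • n - l ∈ decagon v → l ∈ G := by
    intro l hl
    by_cases hG : l ∈ G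
    · exact Filter.Eventually.of_forall fun _ _ => hG
    by_cases hx : x - l ∈ decagon v
    · have : ∃ j, edgeForm v j (x - l) = 0 ∧ cross (v (j + 1) - v j) n ≤ 0 := by
        by_contra! hc
        exact hG ⟨hl.1, hx, hc⟩
      obtain ⟨j, hj, hjn⟩ := this
      have hjn' := lt_of_le_of_ne hjn (hn l hl.1 hx j hj)
      filter_upwards [hpos] with ε hε hmem
      rw [hD] at hmem
      have := hmem j
      rw [edgeForm_add_smul_sub, hj] at this
      nlinarith
    · rw [hD] at hx
      have : ∃ j, edgeForm v j (x - l) < 0 := by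
        by_contra! hc
        exact hx hc
      obtain ⟨j, hj⟩ := this
      filter_upwards [(hcont l j).eventually (Iio_mem_nhds hj)] with ε hε hmem
      rw [hD] at hmem
      exact absurd (hmem j) (not_le.2 hε)
  have hin : ∀ l ∈ S, ∀ᶠ ε : ℝ in nhdsWithin 0 (Set.Ioi 0),
      l ∈ G → x + ε • n - l ∈ interior (decagon v) := by
    intro l hl
    by_cases hG : l ∈ G
    · have : ∀ j, ∀ᶠ ε : ℝ in nhdsWithin 0 (Set.Ioi 0), 0 < edgeForm v j (x + ε • n - l) := by
        intro j
        have h0 : 0 ≤ edgeForm v j (x - l) := by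
          have := hG.2.1
          rw [hD] at this
          exact this j
        rcases h0.eq_or_lt with h0 | h0
        · filter_upwards [hpos] with ε hε
          rw [edgeForm_add_smul_sub, ← h0, zero_add]
          exact mul_pos hε (hG.2.2 j h0.symm)
        · exact (hcont l j).eventually (Ioi_mem_nhds h0)
      filter_upwards [Filter.eventually_all.2 this] with ε hε _
      rw [hI]
      exact hε
    · exact Filter.Eventually.of_forall fun _ h => absurd h hG
  obtain ⟨ε, h1, h2, h3, h4⟩ := (((Filter.eventually_all_finite hSfin).2 hout).and
    (((Filter.eventually_all_finite hSfin).2 hin).and (hpos.and hle))).exists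
  have hGS : ∀ l ∈ G, l ∈ S := fun l hl => hS 0 le_rfl zero_le_one l hl.1 (by simpa using hl.2.1)
  apply le_antisymm
  · refine le_trans (Set.encard_le_encard fun l hl => ?_) (ht.2 (x + ε • n))
    exact ⟨hl.1, h2 l (hGS l hl) hl⟩
  · refine le_trans (ht.1 (x + ε • n)) (Set.encard_le_encard fun l hl => ?_)
    exact h1 l (hS ε h3.le h4.le l hl.1 hl.2) hl.2

/-- At a point which lies on no boundary edge with another direction, as many translates have the
point on their `i`-th edge as have it on an edge parallel to that one. -/
lemma IsKFoldTiling.encard_edge_eq {k : ℕ} {v : Fin 10 → Plane} (hv : IsPosCycle v)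
    (ht : IsKFoldTiling k (decagon v) intLattice) (i : Fin 10) (x : Plane)
    (hx : ∀ l ∈ intLattice, x - l ∈ decagon v → ∀ j, edgeForm v j (x - l) = 0 →
      cross (v (i + 1) - v i) (v (j + 1) - v j) = 0) :
    {l | l ∈ intLattice ∧ x - l ∈ decagon v ∧ edgeForm v i (x - l) = 0}.encard =
      {l | l ∈ intLattice ∧ x - l ∈ decagon v ∧ ∃ j ≠ i, edgeForm v j (x - l) = 0}.encard := by
  -- The next edge vector points inwards across edge `i`, hence outwards across every other edge
  -- parallel to it, as those have the opposite direction.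
  set n := v (i + 1 + 1) - v (i + 1)
  have hni := hv.cross_edge_succ i
  have hneg : ∀ l ∈ intLattice, x - l ∈ decagon v → ∀ j ≠ i, edgeForm v j (x - l) = 0 →
      cross (v (j + 1) - v j) n < 0 := by
    intro l hl hxl j hj hjl
    obtain ⟨r, hr, e⟩ := hv.exists_neg_smul_of_cross_eq_zero hj (hx l hl hxl j hjl)
    rw [e, cross_neg_left, cross_smul_left]
    have := mul_pos hr hni
    linarith
  have hne : ∀ l ∈ intLattice, x - l ∈ decagon v → ∀ j, edgeForm v j (x - l) = 0 →
      cross (v (j + 1) - v j) n ≠ 0 := by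
    intro l hl hxl j hjl
    by_cases hj : j = i
    · rw [hj]; exact hni.ne'
    · exact (hneg l hl hxl j hj hjl).ne
  have c1 := ht.encard_pushed hv x n hne
  have c2 := ht.encard_pushed hv x (-n) fun l hl hxl j hjl => by
    rw [cross_neg_right, neg_ne_zero]; exact hne l hl hxl j hjl
  set L := {l | l ∈ intLattice ∧ x - l ∈ decagon v}
  set P := {l | l ∈ intLattice ∧ x - l ∈ decagon v ∧ edgeForm v i (x - l) = 0}
  set M := {l | l ∈ intLattice ∧ x - l ∈ decagon v ∧ ∃ j ≠ i, edgeForm v j (x - l) = 0}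
  have e1 : {l | l ∈ intLattice ∧ x - l ∈ decagon v ∧
      ∀ j, edgeForm v j (x - l) = 0 → 0 < cross (v (j + 1) - v j) n} = L \ M := by
    ext l
    constructor
    · rintro ⟨h1, h2, h3⟩
      refine ⟨⟨h1, h2⟩, ?_⟩
      rintro ⟨-, -, j, hj, hjl⟩
      exact lt_asymm (h3 j hjl) (hneg l h1 h2 j hj hjl)
    · rintro ⟨⟨h1, h2⟩, h3⟩
      refine ⟨h1, h2, fun j hjl => ?_⟩
      obtain rfl : j = i := by
        by_contra hj
        exact h3 ⟨h1, h2, j, hj, hjl⟩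
      exact hni
  have e2 : {l | l ∈ intLattice ∧ x - l ∈ decagon v ∧
      ∀ j, edgeForm v j (x - l) = 0 → 0 < cross (v (j + 1) - v j) (-n)} = L \ P := by
    simp only [cross_neg_right, neg_pos]
    ext l
    constructor
    · rintro ⟨h1, h2, h3⟩
      refine ⟨⟨h1, h2⟩, ?_⟩
      rintro ⟨-, -, hil⟩
      exact lt_asymm (h3 i hil) hni
    · rintro ⟨⟨h1, h2⟩, h3⟩
      refine ⟨h1, h2, fun j hjl => ?_⟩
      refine hneg l h1 h2 j ?_ hjl
      rintro rfl
      exact h3 ⟨h1, h2, hjl⟩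
  -- Pushing along `n` loses exactly `M`, pushing along `-n` exactly `P`; both leave `k` translates,
  -- and finiteness of `k` allows cancellation.
  rw [e1] at c1
  rw [e2] at c2
  have d1 := Set.encard_sdiff_add_encard_of_subset (show M ⊆ L from fun l hl => ⟨hl.1, hl.2.1⟩)
  have d2 := Set.encard_sdiff_add_encard_of_subset (show P ⊆ L from fun l hl => ⟨hl.1, hl.2.1⟩)
  rw [c1] at d1
  rw [c2, ← d1] at d2
  exact ENat.add_right_injective_of_ne_top (ENat.natCast_ne_top k) d2

/-- The multiples of a non-zero vector lying in the integer lattice form a cyclic group. -/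
lemma exists_zmultiples_smul_mem_intLattice {e : Plane} (he : e ≠ 0) :
    ∃ p : ℝ, ∀ s : ℝ, s • e ∈ intLattice ↔ s ∈ AddSubgroup.zmultiples p := by
  let S : AddSubgroup ℝ :=
    intLattice.toAddSubgroup.comap (LinearMap.toSpanSingleton ℝ Plane e).toAddMonoidHom
  have hS : ∀ s : ℝ, s • e ∈ intLattice ↔ s ∈ S := fun s => Iff.rfl
  rcases AddSubgroup.dense_or_cyclic S with hd | ⟨p, hp⟩
  · exfalso
    -- A lattice vector `s • e` with `s` positive and below this bound has integer coordinates of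
    -- absolute value less than 1, forcing `e = 0`.
    have hδ : 0 < 1 / (1 + |e 0| + |e 1|) := by positivity
    obtain ⟨s, hs, hs0, hs1⟩ := hd.exists_mem_open isOpen_Ioo (Set.nonempty_Ioo.2 hδ)
    obtain ⟨m, n, hmn⟩ := (mem_intLattice_iff _).1 ((hS s).2 hs)
    have h0 : s * e 0 = m := by simpa using congrArg (fun y : Plane => y 0) hmn
    have h1 : s * e 1 = n := by simpa using congrArg (fun y : Plane => y 1) hmn
    rw [lt_div_iff₀ (by positivity)] at hs1
    have small : ∀ (m : ℤ) (a : ℝ), s * a = m → |a| ≤ |e 0| + |e 1| → a = 0 := by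
      intro m a hm ha
      have : |(m : ℝ)| < 1 := by
        rw [← hm, abs_mul, abs_of_pos hs0]
        nlinarith
      have hm0 : m = 0 := by
        rw [← Int.cast_abs] at this
        have : |m| < 1 := by exact_mod_cast this
        exact Int.abs_lt_one_iff.1 this
      rw [hm0, Int.cast_zero] at hm
      exact (mul_eq_zero.1 hm).resolve_left hs0.ne'
    refine he (plane_ext ?_ ?_)
    · exact small m _ h0 (by linarith [abs_nonneg (e 1)])
    · exact small n _ h1 (by linarith [abs_nonneg (e 0)])
  · refine ⟨p, fun s => ?_⟩
    rw [hS, hp, AddSubgroup.zmultiples_eq_closure]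

lemma countable_intLattice : (intLattice : Set Plane).Countable := by
  have : (intLattice : Set Plane) =
      Set.range fun p : ℤ × ℤ => (!₂[(p.1 : ℝ), (p.2 : ℝ)] : Plane) := by
    ext l
    simp only [SetLike.mem_coe, mem_intLattice_iff, Set.mem_range, Prod.exists, eq_comm]
  rw [this]
  exact Set.countable_range _

/-- In a lattice tiling every edge has an opposite edge of the same length, which is a lattice
translate of it unless the edge is itself a lattice vector. -/
lemma IsKFoldTiling.exists_opposite_edge {k : ℕ} {v : Fin 10 → Plane} (hv : IsPosCycle v)
    (ht : IsKFoldTiling k (decagon v) intLattice) (i : Fin 10) :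
    ∃ j ≠ i, v (j + 1) - v j = -(v (i + 1) - v i) ∧ ∃ l ∈ intLattice, ∃ c : ℝ,
      v i = v (j + 1) + l + c • (v (i + 1) - v i) ∧
        (c • (v (i + 1) - v i) ∈ intLattice ∨ v (i + 1) - v i ∈ intLattice) := by
  set e := v (i + 1) - v i with he
  have he0 : e ≠ 0 := hv.edge_ne_zero i
  obtain ⟨p, hp⟩ := exists_zmultiples_smul_mem_intLattice he0
  -- Parameters at which the line along edge `i` meets the supporting line of a non-parallel edge of
  -- some translate: at most one for each pair `(l, j)`.
  let B : Set ℝ := ⋃ l ∈ (intLattice : Set Plane), ⋃ j : Fin 10,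
    {t | cross e (v (j + 1) - v j) ≠ 0 ∧ edgeForm v j (v i + t • e - l) = 0}
  have hB : B.Countable := by
    refine countable_intLattice.biUnion fun l _ => Set.countable_iUnion fun j => ?_
    refine Set.Subsingleton.countable ?_
    rintro t ⟨ht, h1⟩ t' ⟨-, h2⟩
    rw [edgeForm_add_smul_sub] at h1 h2
    have h3 : (t - t') * cross (v (j + 1) - v j) e = 0 := by linarith
    rw [cross_swap] at ht
    have := (mul_eq_zero.1 h3).resolve_right fun h => ht (by rw [h, neg_zero])
    linarith
  have hgen : ∀ t ∉ B, ∀ l ∈ intLattice, v i + t • e - l ∈ decagon v → ∀ j,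
      edgeForm v j (v i + t • e - l) = 0 → cross e (v (j + 1) - v j) = 0 := by
    intro t htB l hl _ j hj
    by_contra hne
    exact htB (Set.mem_biUnion (x := l) hl (Set.mem_iUnion.2 ⟨j, hne, hj⟩))
  have hP : ∀ t, {l | l ∈ intLattice ∧ v i + t • e - l ∈ decagon v ∧
      edgeForm v i (v i + t • e - l) = 0} =
      (fun s : ℝ => s • e) '' {s | s ∈ AddSubgroup.zmultiples p ∧ 0 ≤ t - s ∧ t - s ≤ 1} := by
    intro t
    ext l
    constructor
    · rintro ⟨hl, hx⟩
      obtain ⟨τ, h0, h1, h2⟩ := (hv.mem_edge_iff i _).1 hx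
      have hl' : l = (t - τ) • e := by
        rw [← he] at h2
        have : l = v i + t • e - (v i + τ • e) := by rw [← h2]; abel
        rw [this]
        module
      refine ⟨t - τ, ⟨(hp _).1 (hl' ▸ hl), by linarith, by linarith⟩, hl'.symm⟩
    · rintro ⟨s, ⟨hs, h0, h1⟩, rfl⟩
      refine ⟨(hp s).2 hs, (hv.mem_edge_iff i _).2 ⟨t - s, h0, h1, ?_⟩⟩
      rw [← he]
      module
  have hinj : Function.Injective fun s : ℝ => s • e := smul_left_injective ℝ he0
  -- At a generic interior point of edge `i` the untranslated decagon contributes to one count, so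
  -- the other count is non-empty and supplies the opposite edge `j`.
  obtain ⟨t₀, h0, h1, ht₀⟩ := exists_notMem_of_countable hB one_pos
  have hcross := ht.encard_edge_eq hv i (v i + t₀ • e) (hgen t₀ ht₀)
  have hne : {l | l ∈ intLattice ∧ v i + t₀ • e - l ∈ decagon v ∧
      ∃ j ≠ i, edgeForm v j (v i + t₀ • e - l) = 0}.Nonempty := by
    rw [← Set.encard_ne_zero, ← hcross, Set.encard_ne_zero]
    rw [hP]
    exact ⟨_, 0, ⟨zero_mem _, by linarith, by linarith⟩, rfl⟩
  obtain ⟨l₀, hl₀, hx₀, j, hji, hj⟩ := hne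
  obtain ⟨r, hr, her⟩ := hv.exists_neg_smul_of_cross_eq_zero hji (hgen t₀ ht₀ l₀ hl₀ hx₀ j hj)
  rw [← he] at her
  have hvj : v j = v (j + 1) + r • e := by
    rw [← neg_eq_iff_eq_neg] at her
    rw [← her]; abel
  obtain ⟨τ₀, -, -, hτ₀⟩ := (hv.mem_edge_iff j _).1 ⟨hx₀, hj⟩
  -- `c` measures how far, in units of `e`, the end `v (j + 1) + l₀` of the translated opposite edge
  -- is displaced from `v i`.
  set c := (1 - τ₀) * r - t₀ with hc
  have hvi : v i = v (j + 1) + l₀ + c • e := by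
    rw [her] at hτ₀
    rw [hc]
    have h3 : v i = v j + τ₀ • -(r • e) + l₀ - t₀ • e := by rw [← hτ₀]; abel
    rw [h3, hvj]
    module
  have hM : ∀ t ∉ B, {l | l ∈ intLattice ∧ v i + t • e - l ∈ decagon v ∧
      ∃ j ≠ i, edgeForm v j (v i + t • e - l) = 0} =
      (fun s : ℝ => l₀ + s • e) ''
        {s | s ∈ AddSubgroup.zmultiples p ∧ 0 ≤ t + c - s ∧ t + c - s ≤ r} := by
    intro t htB
    ext l
    constructor
    · rintro ⟨hl, hx, j', hj'i, hj'⟩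
      -- Two distinct edges both antiparallel to `e` would be parallel in the same direction, which
      -- convexity forbids.
      obtain rfl : j' = j := by
        by_contra hjj
        obtain ⟨r', hr', her'⟩ :=
          hv.exists_neg_smul_of_cross_eq_zero hj'i (hgen t htB l hl hx j' hj')
        rw [← he] at her'
        obtain ⟨r'', hr'', her''⟩ := hv.exists_neg_smul_of_cross_eq_zero hjj (by
          rw [her, her', cross_neg_left, cross_neg_right, cross_smul_left, cross_smul_right,
            cross_same]; ring)
        rw [her, her'] at her''
        have : (r' + r'' * r) • e = 0 := by
          have h4 : r' • e = -((r'' * r) • e) := by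
            rw [mul_smul]
            have := congrArg Neg.neg her''
            simpa using this
          rw [add_smul, h4]; abel
        have h5 := (smul_eq_zero.1 this).resolve_right he0
        have := mul_pos hr'' hr
        linarith
      obtain ⟨τ, g0, g1, g2⟩ := (hv.mem_edge_iff j' _).1 ⟨hx, hj'⟩
      have hl' : l = l₀ + (t + c - (1 - τ) * r) • e := by
        rw [her, hvj] at g2
        have : l = v i + t • e - (v (j' + 1) + r • e + τ • -(r • e)) := by rw [← g2]; abel
        rw [this, hvi]
        module
      have hs : (t + c - (1 - τ) * r) • e ∈ intLattice := by
        have := intLattice.sub_mem hl hl₀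
        rwa [hl', add_sub_cancel_left] at this
      refine ⟨_, ⟨(hp _).1 hs, ?_, ?_⟩, hl'.symm⟩
      · have : 0 ≤ (1 - τ) * r := mul_nonneg (by linarith) hr.le
        linarith
      · have : 0 ≤ τ * r := mul_nonneg g0 hr.le
        linarith
    · rintro ⟨s, ⟨hs, g0, g1⟩, rfl⟩
      have hmem := (hv.mem_edge_iff j (v i + t • e - (l₀ + s • e))).2
        ⟨1 - (t + c - s) / r, by rw [sub_nonneg, div_le_one hr]; exact g1,
          by linarith [div_nonneg g0 hr.le], by
          rw [her, hvj, hvi, smul_neg, smul_smul,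
            show (1 - (t + c - s) / r) * r = r - (t + c - s) by field_simp]
          module⟩
      exact ⟨intLattice.add_mem hl₀ ((hp s).2 hs), hmem.1, j, hji, hmem.2⟩
  have key : ∀ t ∉ B,
      {s : ℝ | s ∈ AddSubgroup.zmultiples p ∧ 0 ≤ t - s ∧ t - s ≤ 1}.encard =
      {s : ℝ | s ∈ AddSubgroup.zmultiples p ∧ 0 ≤ t + c - s ∧ t + c - s ≤ r}.encard := by
    intro t htB
    have := ht.encard_edge_eq hv i (v i + t • e) (hgen t htB)
    rwa [hP, hM t htB, hinj.encard_image,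
      Function.Injective.encard_image fun a b hab => hinj (add_left_cancel hab)] at this
  obtain ⟨rfl, hor⟩ := eq_one_of_encard_eq hr hB key
  refine ⟨j, hji, by rw [her, one_smul], l₀, hl₀, c, hvi, ?_⟩
  rw [← hp, ← hp, one_smul] at hor
  exact hor

/-! ### Central symmetry from opposite edges. -/

/-- The edges between two antiparallel edges of a convex polygon turn to the left of the first. -/
lemma IsPosCycle.cross_edge_pos {v : Fin 10 → Plane} (h : IsPosCycle v) (i : Fin 10) {k m : ℕ}
    (hk : k < 10) (hm : 1 ≤ m) (hmk : m < k)
    (he : v (i + idx k + 1) - v (i + idx k) = -(v (i + 1) - v i)) :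
    0 < cross (v (i + 1) - v i) (v (i + idx m + 1) - v (i + idx m)) := by
  rcases hm.eq_or_lt with rfl | hm
  · exact h.cross_edge_succ i
  by_contra! hle
  set a := v (i + 1) - v i with ha
  set b := v (i + idx m + 1) - v (i + idx m) with hb
  have q1 := h.cross_diag (i + 1) (k := m - 1) (l := k - 1) (by omega) (by omega) (by omega)
  have hs : ∀ n, 1 ≤ n → diag v (i + 1) (n - 1) = v (i + idx n) - v (i + 1) := by
    intro n hn
    obtain ⟨n, rfl⟩ := Nat.exists_eq_add_of_le' hn
    rw [diag, Nat.add_sub_cancel, idx_succ, add_assoc, add_comm 1]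
  rw [hs m hm.le, hs k (by omega)] at q1
  have q2 : 0 < cross a (v (i + idx m) - v (i + 1)) := by
    have := h i (i + idx m) ?_ (add_idx_ne i (by omega) (by norm_num) (by omega) : _ ≠ i + idx 1)
    · have e : cross a (v (i + idx m) - v (i + 1)) = cross a (v (i + idx m) - v i) := by
        simp only [ha, cross, PiLp.sub_apply]; ring
      rwa [e]
    · have := add_idx_ne i (show m < 10 by omega) (show 0 < 10 by norm_num) (by omega)
      rwa [add_idx_zero] at this
  have q3 : 0 ≤ cross b (v (i + idx k) - v (i + idx m)) :=
    h.edgeForm_vertex_nonneg (i + idx m) (i + idx k)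
  have q4 : 0 < cross a (v (i + idx k) - v (i + idx m)) := by
    have hk9 : k ≠ 9 := by
      rintro rfl
      have := h.cross_edge_succ (i + idx 9)
      rw [he, show i + idx 9 + 1 = i from by rw [add_assoc]; exact add_zero i, cross_neg_left,
        cross_same] at this
      simp at this
    have := h (i + idx k) (i + idx m) (add_idx_ne i (by omega) hk (by omega)) (by
      rw [add_assoc, ← idx_succ]
      exact add_idx_ne i (by omega) (by omega) (by omega))
    rw [he, cross_neg_left, ← cross_neg_right, neg_sub] at this
    exact this
  have q5 : cross b (v (i + idx m) - v (i + 1)) < 0 := by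
    have := h (i + idx m) (i + 1) (add_idx_ne i (k := 1) (by norm_num) (by omega) (by omega)) (by
      rw [add_assoc, ← idx_succ]
      exact add_idx_ne i (k := 1) (by norm_num) (by omega) (by omega))
    rw [← neg_sub (v (i + idx m)) (v (i + 1)), cross_neg_right] at this
    linarith
  -- By this identity a non-positive `cross a b` would make the left side non-positive, while `q2`
  -- to `q5` make the right side positive.
  have key : cross a b * cross (v (i + idx m) - v (i + 1)) (v (i + idx k) - v (i + 1)) =
      cross a (v (i + idx m) - v (i + 1)) * cross b (v (i + idx k) - v (i + idx m)) -
      cross a (v (i + idx k) - v (i + idx m)) * cross b (v (i + idx m) - v (i + 1)) := by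
    simp only [cross, PiLp.sub_apply]; ring
  have r1 := mul_nonneg q2.le q3
  have r2 := mul_neg_of_pos_of_neg q4 q5
  have r3 := mul_nonpos_of_nonpos_of_nonneg hle q1.le
  linarith

/-- A convex decagon in which every edge has an opposite edge is centrally symmetric. -/
lemma IsPosCycle.opposite_edge_eq {v : Fin 10 → Plane} (h : IsPosCycle v)
    (hopp : ∀ i, ∃ j ≠ i, v (j + 1) - v j = -(v (i + 1) - v i)) (i : Fin 10) :
    ∀ j, v (j + 1) - v j = -(v (i + 1) - v i) → j = i + 5 := by
  have hk : ∀ i, ∃ k : ℕ, k < 10 ∧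
      v (i + idx k + 1) - v (i + idx k) = -(v (i + 1) - v i) := by
    intro i
    obtain ⟨j, -, hj⟩ := hopp i
    obtain ⟨k, hk, rfl⟩ := exists_eq_add_idx i j
    exact ⟨k, hk, hj⟩
  choose κ hκ he using hk
  have huniq : ∀ i j j', v (j + 1) - v j = -(v (i + 1) - v i) →
      v (j' + 1) - v j' = -(v (i + 1) - v i) → j = j' := by
    intro i j j' h1 h2
    by_contra hne
    obtain ⟨r, hr, hr'⟩ := h.exists_neg_smul_of_cross_eq_zero (Ne.symm hne)
      (by rw [h1, h2, cross_same])
    rw [h1, h2] at hr'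
    have : (1 + r) • (v (i + 1) - v i) = 0 := by
      rw [add_smul, one_smul, ← neg_inj, neg_add, neg_zero]
      nth_rewrite 1 [hr']
      rw [smul_neg]; abel
    have := (smul_eq_zero.1 this).resolve_right (h.edge_ne_zero i)
    linarith
  -- Otherwise the opposite of edge `i + 1` occurs no later than that of edge `i`: coincidence makes
  -- edges `i` and `i + 1` equal, and lying strictly before contradicts `cross_edge_pos`, since
  -- minus edge `i + 1` turns right of edge `i`.
  have hmono : ∀ i, κ i ≤ κ (i + 1) := by
    intro i
    by_contra! hlt
    have e1 := he (i + 1)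
    rw [show i + 1 + idx (κ (i + 1)) = i + idx (κ (i + 1) + 1) by
      rw [idx_succ, add_assoc, add_comm 1]] at e1
    have hs := h.cross_edge_succ i
    rcases (show κ (i + 1) + 1 ≤ κ i by omega).eq_or_lt with hlt | hlt
    · rw [hlt, he i] at e1
      rw [neg_inj] at e1
      rw [← e1, cross_same] at hs
      exact lt_irrefl _ hs
    · have := h.cross_edge_pos i (hκ i) (by omega) hlt (he i)
      rw [e1, cross_neg_right] at this
      linarith
  -- A function that never decreases around a cycle is constant.
  have hconst : ∀ i, κ i = κ 0 := by
    have hc : ∀ n d, κ (idx n) ≤ κ (idx (n + d)) := by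
      intro n d
      induction d with
      | zero => exact le_rfl
      | succ d ih => rw [← add_assoc, idx_succ]; exact ih.trans (hmono _)
    intro i
    obtain ⟨n, hn, rfl⟩ := exists_eq_add_idx 0 i
    rw [zero_add]
    have h1 := hc n (10 - n)
    have h2 := hc 0 n
    rw [Nat.add_sub_cancel' hn.le] at h1
    rw [Nat.zero_add] at h2
    exact le_antisymm h1 h2
  -- Taking opposites is an involution, so the offset is 0 or 5; offset 0 would make an edge vanish.
  have hinv : ∀ i, i + idx (κ 0) + idx (κ 0) = i := by
    intro i
    have e1 := he i
    have e2 := he (i + idx (κ i))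
    rw [e1] at e2
    have := huniq (i + idx (κ i)) _ i (by rw [e2, e1]) (by rw [e1, neg_neg])
    rwa [hconst (i + idx (κ i)), hconst i] at this
  have h5 : idx (κ 0) = 0 ∨ idx (κ 0) = 5 := by
    have := hinv 0
    revert this
    generalize idx (κ 0) = q
    revert q
    decide
  intro j hj
  have := huniq i j (i + idx (κ i)) hj (he i)
  rw [this, hconst]
  rcases h5 with h5 | h5
  · exfalso
    have e1 := he i
    rw [hconst, h5, add_zero] at e1
    have := h.edge_ne_zero i
    have e2 : (2 : ℝ) • (v (i + 1) - v i) = 0 := by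
      rw [two_smul]; nth_rewrite 1 [e1]; abel
    exact this ((smul_eq_zero.1 e2).resolve_left two_ne_zero)
  · rw [h5]

/-! ### The area bound. -/

open MeasureTheory Pointwise in
/-- The packing inequality. -/
lemma IsKFoldTiling.volume_interior_le {k : ℕ} {K : Set Plane}
    (h : IsKFoldTiling k K intLattice) : volume (interior K) ≤ k := by
  let B := (EuclideanSpace.basisFun (Fin 2) ℝ).toBasis
  let L := Submodule.span ℤ (Set.range B)
  have hL : ∀ l, l ∈ L ↔ l ∈ intLattice := fun l => Iff.rfl
  let F := ZSpan.fundamentalDomain B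
  have hF : volume F = 1 := by
    rw [measure_congr (ZSpan.fundamentalDomain_ae_parallelepiped B volume)]
    simpa [B] using (EuclideanSpace.basisFun (Fin 2) ℝ).volume_parallelepiped
  have hfund : IsAddFundamentalDomain L F volume := ZSpan.isAddFundamentalDomain B volume
  have : VAddInvariantMeasure L Plane volume :=
    (inferInstance : VAddInvariantMeasure L.toAddSubgroup Plane volume)
  have hmeas : ∀ g : L, MeasurableSet (g +ᵥ interior K) := fun g =>
    (isOpen_interior.vadd g).measurableSet
  -- Cut along a fundamental domain `F` of area 1, the area of the interior is the integral over `F`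
  -- of the number of translates covering a point, which is at most `k`.
  rw [hfund.measure_eq_tsum (interior K)]
  have e : ∀ g : L, volume ((g +ᵥ interior K) ∩ F) =
      ∫⁻ x in F, (g +ᵥ interior K).indicator (fun _ => 1) x := by
    intro g
    rw [lintegral_indicator (hmeas g), setLIntegral_one, Measure.restrict_apply (hmeas g)]
  simp_rw [e]
  have hcount : Countable L := inferInstance
  rw [← lintegral_tsum fun g => (measurable_const.indicator (hmeas g)).aemeasurable]
  calc ∫⁻ x in F, ∑' g : L, (g +ᵥ interior K).indicator (fun _ => (1 : ENNReal)) x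
      ≤ ∫⁻ _ in F, (k : ENNReal) := by
        refine lintegral_mono fun x => ?_
        rw [ENNReal.tsum_eq_iSup_sum]
        refine iSup_le fun s => ?_
        classical
        have h1 : ∑ g ∈ s, (g +ᵥ interior K).indicator (fun _ => (1 : ENNReal)) x =
            ((s.filter fun g : L => x ∈ g +ᵥ interior K).card : ENNReal) := by
          simp [Set.indicator_apply]
        rw [h1]
        have h2 : (((s.filter fun g : L => x ∈ g +ᵥ interior K).card : ℕ) : ℕ∞) ≤ k := by
          refine le_trans ?_ (h.2 x)
          rw [← Set.encard_coe_eq_coe_finsetCard,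
            ← Function.Injective.encard_image Subtype.val_injective]
          refine Set.encard_le_encard ?_
          rintro _ ⟨g, hg, rfl⟩
          have := (Finset.mem_filter.1 hg).2
          refine ⟨(hL _).1 g.2, ?_⟩
          rw [Set.mem_vadd_set_iff_neg_vadd_mem] at this
          rw [sub_eq_neg_add]
          exact this
        exact_mod_cast (ENat.natCast_le_natCast.1 h2)
    _ = k := by simp [hF]

open MeasureTheory in
lemma volume_stdTriangle :
    volume {x : Plane | 0 < x 0 ∧ 0 < x 1 ∧ x 0 + x 1 < 1} = ENNReal.ofReal (1 / 2) := by
  let R := regionBetween (fun _ : ℝ => (0 : ℝ)) (fun x => 1 - x) (Set.Ioo 0 1)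
  have hR : MeasurableSet R := measurableSet_regionBetween measurable_const
    (measurable_const.sub measurable_id) measurableSet_Ioo
  have e : {x : Plane | 0 < x 0 ∧ 0 < x 1 ∧ x 0 + x 1 < 1} =
      (fun x : Plane => (MeasurableEquiv.finTwoArrow (α := ℝ)) (WithLp.ofLp x)) ⁻¹' R := by
    ext x
    simp only [R, regionBetween, Set.mem_preimage, Set.mem_ofPred_eq, Set.mem_Ioo,
      MeasurableEquiv.finTwoArrow_apply]
    constructor
    · rintro ⟨h1, h2, h3⟩
      exact ⟨⟨h1, by linarith⟩, h2, by linarith⟩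
    · rintro ⟨⟨h1, -⟩, h2, h3⟩
      exact ⟨h1, h2, by linarith⟩
  have hp : MeasurePreserving
      (fun x : Plane => (MeasurableEquiv.finTwoArrow (α := ℝ)) (WithLp.ofLp x)) :=
    (volume_preserving_finTwoArrow ℝ).comp (PiLp.volume_preserving_ofLp (Fin 2))
  rw [e, hp.measure_preimage hR.nullMeasurableSet]
  have := volume_regionBetween_eq_integral (μ := volume) (f := fun _ : ℝ => (0 : ℝ))
    (g := fun x => 1 - x) (s := Set.Ioo 0 1)
    (by simp) ((continuous_const.sub continuous_id).integrableOn_Icc.mono_set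
      Set.Ioo_subset_Icc_self) measurableSet_Ioo (fun x hx => by linarith [hx.2])
  rw [Measure.volume_eq_prod, this]
  congr 1
  rw [← integral_Ioc_eq_integral_Ioo, ← intervalIntegral.integral_of_le zero_le_one]
  simp only [Pi.sub_apply, sub_zero]
  rw [intervalIntegral.integral_sub intervalIntegrable_const
    intervalIntegral.intervalIntegrable_id, integral_id]
  norm_num

/-- The open triangle with vertices `p`, `p + a`, `p + b`, in counter-clockwise order. -/
def openTriangle (p a b : Plane) : Set Plane :=
  {x | 0 < cross a (x - p) ∧ cross b (x - p) < 0 ∧ 0 < cross (b - a) (x - p - a)}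

lemma isOpen_openTriangle (p a b : Plane) : IsOpen (openTriangle p a b) := by
  have c : ∀ a q : Plane, Continuous fun x : Plane => cross a (x - q) := fun a q =>
    (continuous_cross a).comp (continuous_id.sub continuous_const)
  have h : IsOpen {x : Plane | 0 < cross (b - a) (x - p - a)} := by
    simp only [sub_sub]
    exact isOpen_lt continuous_const (c (b - a) (p + a))
  exact (isOpen_lt continuous_const (c a p)).inter ((isOpen_lt (c b p) continuous_const).inter h)

open MeasureTheory in
lemma volume_openTriangle {p a b : Plane} (hC : 0 < cross a b) :
    volume (openTriangle p a b) = ENNReal.ofReal (cross a b / 2) := by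
  let B := (EuclideanSpace.basisFun (Fin 2) ℝ).toBasis
  let f : Plane →ₗ[ℝ] Plane := Matrix.toLin B B !![a 0, b 0; a 1, b 1]
  have hf : ∀ x, f x = x 0 • a + x 1 • b := by
    intro x
    apply plane_ext <;> simp [f, B, Matrix.toLin_apply, Matrix.mulVec, dotProduct] <;> ring
  have hdet : LinearMap.det f = cross a b := by
    rw [LinearMap.det_toLin, Matrix.det_fin_two_of, cross]; ring
  have e : openTriangle p a b =
      (fun y => p + y) '' (f '' {x : Plane | 0 < x 0 ∧ 0 < x 1 ∧ x 0 + x 1 < 1}) := by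
    ext x
    constructor
    · rintro ⟨h1, h2, h3⟩
      have e := cross_smul_eq a b (x - p)
      refine ⟨x - p, ⟨!₂[cross (x - p) b / cross a b, cross a (x - p) / cross a b], ?_, ?_⟩,
        by simp⟩
      · refine ⟨?_, ?_, ?_⟩
        · simp only [Matrix.cons_val_zero]
          exact div_pos (by rw [cross_swap]; linarith) hC
        · simp only [Matrix.cons_val_one, Matrix.cons_val_zero]
          exact div_pos h1 hC
        · simp only [Matrix.cons_val_one, Matrix.cons_val_zero]
          rw [← add_div, div_lt_one hC]
          have : cross (b - a) (x - p - a) = cross a b - (cross (x - p) b + cross a (x - p)) := by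
            simp only [cross, PiLp.sub_apply]; ring
          linarith
      · rw [hf]
        have := congrArg (fun y => (cross a b)⁻¹ • y) e
        simp only [smul_add, smul_smul, inv_mul_cancel₀ hC.ne', one_smul] at this
        refine Eq.trans ?_ this.symm
        simp [div_eq_inv_mul]
    · rintro ⟨_, ⟨y, ⟨h1, h2, h3⟩, rfl⟩, rfl⟩
      have e1 : cross a (p + f y - p) = y 1 * cross a b := by
        rw [hf, add_sub_cancel_left, cross_add_right, cross_smul_right, cross_smul_right,
          cross_same]; ring
      have e2 : cross b (p + f y - p) = -(y 0 * cross a b) := by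
        rw [hf, add_sub_cancel_left, cross_add_right, cross_smul_right, cross_smul_right,
          cross_same, cross_swap b a]; ring
      have e3 : cross (b - a) (p + f y - p - a) = (1 - y 0 - y 1) * cross a b := by
        rw [hf]
        simp only [cross, PiLp.sub_apply, PiLp.add_apply, PiLp.smul_apply, smul_eq_mul]; ring
      refine ⟨?_, ?_, ?_⟩
      · show 0 < cross a (p + f y - p)
        rw [e1]; exact mul_pos h2 hC
      · show cross b (p + f y - p) < 0
        rw [e2]; linarith [mul_pos h1 hC]
      · show 0 < cross (b - a) (p + f y - p - a)
        rw [e3]; exact mul_pos (by linarith) hC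
  rw [e, Set.image_add_left, measure_preimage_add, Measure.addHaar_image_linearMap, hdet,
    volume_stdTriangle, ← ENNReal.ofReal_mul (abs_nonneg _), abs_of_pos hC]
  ring_nf

open MeasureTheory in
/-- The area formula turned into a bound: the fan of triangles at a vertex fits into the decagon. -/
lemma IsKFoldTiling.sum_cross_diag_le {k : ℕ} {v : Fin 10 → Plane} (hv : IsPosCycle v)
    (ht : IsKFoldTiling k (decagon v) intLattice) :
    ∑ m ∈ Finset.range 8, cross (diag v 0 (m + 1)) (diag v 0 (m + 2)) ≤ 2 * k := by
  let T : ℕ → Set Plane := fun m => openTriangle (v 0) (diag v 0 (m + 1)) (diag v 0 (m + 2))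
  have hpos : ∀ m ∈ Finset.range 8, 0 < cross (diag v 0 (m + 1)) (diag v 0 (m + 2)) := by
    intro m hm
    have := Finset.mem_range.1 hm
    exact hv.cross_diag 0 (by omega) (by omega) (by omega)
  have hsub : ∀ m ∈ Finset.range 8, T m ⊆ interior (decagon v) := by
    intro m hm
    refine interior_maximal ?_ (isOpen_openTriangle _ _ _)
    rintro x ⟨h1, h2, h3⟩
    have hmem : ∀ n, v 0 + diag v 0 n ∈ Set.range v := fun n => ⟨idx n, by simp [diag]⟩
    exact mem_convexHull_of_sector (hpos m hm) h1.le h2.le h3.le ⟨0, rfl⟩ (hmem _) (hmem _)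
  have hdisj' : ∀ m n, m < n → n < 8 → Disjoint (T m) (T n) := by
    intro m n hmn hn
    rw [Set.disjoint_left]
    rintro x ⟨-, h1, -⟩ ⟨h2, h3, -⟩
    have hC := hpos n (Finset.mem_range.2 hn)
    -- Expanding `x - v 0` in the two later diagonals puts `x` to the left of diagonal `m + 2`,
    -- whereas membership in the earlier triangle puts it to the right.
    have e := congrArg (cross (diag v 0 (m + 2)))
      (cross_smul_eq (diag v 0 (n + 1)) (diag v 0 (n + 2)) (x - v 0))
    rw [cross_smul_right, cross_add_right, cross_smul_right, cross_smul_right] at e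
    have q1 : 0 ≤ cross (diag v 0 (m + 2)) (diag v 0 (n + 1)) := by
      rcases (show m + 2 ≤ n + 1 by omega).eq_or_lt with h | h
      · rw [h, cross_same]
      · exact (hv.cross_diag 0 (by omega) h (by omega)).le
    have q2 : 0 < cross (diag v 0 (m + 2)) (diag v 0 (n + 2)) :=
      hv.cross_diag 0 (by omega) (by omega) (by omega)
    have q3 : 0 < cross (x - v 0) (diag v 0 (n + 2)) := by rw [cross_swap]; linarith
    have r1 := mul_nonneg q3.le q1
    have r2 := mul_pos h2 q2
    have r3 := mul_neg_of_pos_of_neg hC h1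
    linarith
  have hdisj : Set.PairwiseDisjoint (↑(Finset.range 8)) T := by
    intro m hm n hn hmn
    have hm := Finset.mem_range.1 (Finset.mem_coe.1 hm)
    have hn := Finset.mem_range.1 (Finset.mem_coe.1 hn)
    rcases hmn.lt_or_gt with h | h
    · exact hdisj' m n h hn
    · exact (hdisj' n m h hm).symm
  have hvol : volume (⋃ m ∈ Finset.range 8, T m) ≤ k :=
    (measure_mono (Set.iUnion₂_subset hsub)).trans ht.volume_interior_le
  rw [measure_biUnion_finset hdisj fun m _ => (isOpen_openTriangle _ _ _).measurableSet,
    Finset.sum_congr rfl fun m hm => volume_openTriangle (hpos m hm),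
    ← ENNReal.ofReal_sum_of_nonneg fun m hm => (half_pos (hpos m hm)).le,
    ENNReal.ofReal_le_natCast, ← Finset.sum_div] at hvol
  linarith

/-! ### Lattice edge systems: no exceptional edges. -/

lemma cross_mem_intCast {a b : Plane} (ha : a ∈ intLattice) (hb : b ∈ intLattice) :
    cross a b ∈ (Int.castAddHom ℝ).range := by
  obtain ⟨m, n, rfl⟩ := (mem_intLattice_iff _).1 ha
  obtain ⟨m', n', rfl⟩ := (mem_intLattice_iff _).1 hb
  exact ⟨m * n' - n * m', by simp [cross]⟩

lemma one_le_of_mem_intCast {x : ℝ} (hx : x ∈ (Int.castAddHom ℝ).range) (h : 0 < x) : 1 ≤ x := by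
  obtain ⟨n, rfl⟩ := hx
  simp only [Int.coe_castAddHom] at h ⊢
  have : 0 < n := by exact_mod_cast h
  exact_mod_cast this

/-- The edge vectors of a centrally symmetric decagon of area at most five whose opposite edges are
lattice translates of each other, up to sliding along edges that are lattice vectors. -/
structure IsLatticeEdgeSystem (E : Fin 10 → Plane) : Prop where
  opposite : ∀ i, E (i + 5) = -E i
  cross_one : ∀ i, 0 < cross (E i) (E (i + 1))
  cross_two : ∀ i, 0 < cross (E i) (E (i + 2))
  translate : ∀ i, E (i + 1) + E (i + 2) + E (i + 3) + E (i + 4) ∈ intLattice ∨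
    E i ∈ intLattice ∧ ∃ c : ℝ,
      E (i + 1) + E (i + 2) + E (i + 3) + E (i + 4) + c • E i ∈ intLattice
  area : ∑ i, (cross (E i) (E (i + 1)) + cross (E i) (E (i + 2))) ≤ 10

lemma IsLatticeEdgeSystem.shift {E : Fin 10 → Plane} (h : IsLatticeEdgeSystem E) (k : Fin 10) :
    IsLatticeEdgeSystem fun i => E (i + k) where
  opposite i := by simpa only [add_right_comm _ _ k] using h.opposite (i + k)
  cross_one i := by simpa only [add_right_comm _ _ k] using h.cross_one (i + k)
  cross_two i := by simpa only [add_right_comm _ _ k] using h.cross_two (i + k)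
  translate i := by simpa only [add_right_comm _ _ k] using h.translate (i + k)
  area := by
    refine le_of_eq_of_le ?_ h.area
    refine Fintype.sum_equiv (Equiv.addRight k) _ _ fun i => ?_
    simp only [Equiv.coe_addRight, add_right_comm _ _ k]

lemma six_le_sum_cross {a b c d : Plane} (ha : a ∈ intLattice) (hb : b ∈ intLattice)
    (hc : c ∈ intLattice) (hd : d ∈ intLattice) (hab : 0 < cross a b) (hac : 0 < cross a c)
    (had : 0 < cross a d) (hbc : 0 < cross b c) (hbd : 0 < cross b d) (hcd : 0 < cross c d) :
    6 ≤ cross a b + cross a c + cross a d + cross b c + cross b d + cross c d := by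
  linarith [one_le_of_mem_intCast (cross_mem_intCast ha hb) hab,
    one_le_of_mem_intCast (cross_mem_intCast ha hc) hac,
    one_le_of_mem_intCast (cross_mem_intCast ha hd) had,
    one_le_of_mem_intCast (cross_mem_intCast hb hc) hbc,
    one_le_of_mem_intCast (cross_mem_intCast hb hd) hbd,
    one_le_of_mem_intCast (cross_mem_intCast hc hd) hcd]

/-- If the total of three cross products and the first two of them are integers, so is the third;
all being positive, the last two add up to at least two. -/
lemma two_le_add {x y z : ℝ} (h : x + y + z ∈ (Int.castAddHom ℝ).range)
    (hx : x ∈ (Int.castAddHom ℝ).range) (hy : y ∈ (Int.castAddHom ℝ).range) (hy0 : 0 < y)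
    (hz0 : 0 < z) : 2 ≤ y + z := by
  have hz : z ∈ (Int.castAddHom ℝ).range := by
    have := sub_mem (sub_mem h hx) hy
    rwa [show x + y + z - x - y = z by ring] at this
  linarith [one_le_of_mem_intCast hy hy0, one_le_of_mem_intCast hz hz0]

lemma sum_fin_ten (f : Fin 10 → ℝ) :
    ∑ i, f i = f 0 + f 1 + f 2 + f 3 + f 4 + f 5 + f 6 + f 7 + f 8 + f 9 := by
  simp only [Fin.sum_univ_castSucc, Finset.univ_eq_empty, Finset.sum_empty, zero_add]
  rfl

/-- Up to sign the area is the sum of the ten cross products of `E 0`, ..., `E 4`, all positive once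
ordered. Integrality pushes this sum to at least six, in whichever combination the other edges are
exceptional. -/
lemma IsLatticeEdgeSystem.last_not_exceptional {E : Fin 10 → Plane} (h : IsLatticeEdgeSystem E)
    (h4 : E 4 ∈ intLattice) {c : ℝ} (hc : E 5 + E 6 + E 7 + E 8 + c • E 4 ∈ intLattice) :
    False := by
  have o5 : E 5 = -E 0 := h.opposite 0
  have o6 : E 6 = -E 1 := h.opposite 1
  have o7 : E 7 = -E 2 := h.opposite 2
  have o8 : E 8 = -E 3 := h.opposite 3
  have o9 : E 9 = -E 4 := h.opposite 4
  have p01 : 0 < cross (E 0) (E 1) := h.cross_one 0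
  have p12 : 0 < cross (E 1) (E 2) := h.cross_one 1
  have p23 : 0 < cross (E 2) (E 3) := h.cross_one 2
  have p34 : 0 < cross (E 3) (E 4) := h.cross_one 3
  have p02 : 0 < cross (E 0) (E 2) := h.cross_two 0
  have p13 : 0 < cross (E 1) (E 3) := h.cross_two 1
  have p24 : 0 < cross (E 2) (E 4) := h.cross_two 2
  have p04 : 0 < cross (E 0) (E 4) := by
    have : 0 < cross (E 4) (E 5) := h.cross_one 4
    rwa [o5, cross_neg_right, ← cross_swap] at this
  have p03 : 0 < cross (E 0) (E 3) := by
    have : 0 < cross (E 3) (E 5) := h.cross_two 3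
    rwa [o5, cross_neg_right, ← cross_swap] at this
  have p14 : 0 < cross (E 1) (E 4) := by
    have : 0 < cross (E 4) (E 6) := h.cross_two 4
    rwa [o6, cross_neg_right, ← cross_swap] at this
  have area : cross (E 0) (E 1) + cross (E 0) (E 2) + cross (E 0) (E 3) + cross (E 0) (E 4) +
      cross (E 1) (E 2) + cross (E 1) (E 3) + cross (E 1) (E 4) + cross (E 2) (E 3) +
      cross (E 2) (E 4) + cross (E 3) (E 4) ≤ 5 := by
    have := h.area
    rw [sum_fin_ten] at this
    have q : ∀ i, cross (-E i) (-E (i + 1)) = cross (E i) (E (i + 1)) := by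
      intro i; rw [cross_neg_left, cross_neg_right, neg_neg]
    simp only [show (0 : Fin 10) + 1 = 1 from rfl, show (1 : Fin 10) + 1 = 2 from rfl,
      show (2 : Fin 10) + 1 = 3 from rfl, show (3 : Fin 10) + 1 = 4 from rfl,
      show (4 : Fin 10) + 1 = 5 from rfl, show (5 : Fin 10) + 1 = 6 from rfl,
      show (6 : Fin 10) + 1 = 7 from rfl, show (7 : Fin 10) + 1 = 8 from rfl,
      show (8 : Fin 10) + 1 = 9 from rfl, show (9 : Fin 10) + 1 = 0 from rfl,
      show (0 : Fin 10) + 2 = 2 from rfl, show (1 : Fin 10) + 2 = 3 from rfl,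
      show (2 : Fin 10) + 2 = 4 from rfl, show (3 : Fin 10) + 2 = 5 from rfl,
      show (4 : Fin 10) + 2 = 6 from rfl, show (5 : Fin 10) + 2 = 7 from rfl,
      show (6 : Fin 10) + 2 = 8 from rfl, show (7 : Fin 10) + 2 = 9 from rfl,
      show (8 : Fin 10) + 2 = 0 from rfl, show (9 : Fin 10) + 2 = 1 from rfl, o5, o6, o7, o8, o9,
      cross_neg_left, cross_neg_right, neg_neg] at this
    have s1 := cross_swap (E 0) (E 4)
    have s2 := cross_swap (E 0) (E 3)
    have s3 := cross_swap (E 1) (E 4)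
    linarith
  have t0 : E 1 + E 2 + E 3 + E 4 ∈ intLattice ∨ E 0 ∈ intLattice ∧ ∃ c : ℝ,
    E 1 + E 2 + E 3 + E 4 + c • E 0 ∈ intLattice := h.translate 0
  have t1 : E 2 + E 3 + E 4 + E 5 ∈ intLattice ∨ E 1 ∈ intLattice ∧ ∃ c : ℝ,
    E 2 + E 3 + E 4 + E 5 + c • E 1 ∈ intLattice := h.translate 1
  have t2 : E 3 + E 4 + E 5 + E 6 ∈ intLattice ∨ E 2 ∈ intLattice ∧ ∃ c : ℝ,
    E 3 + E 4 + E 5 + E 6 + c • E 2 ∈ intLattice := h.translate 2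
  have t3 : E 4 + E 5 + E 6 + E 7 ∈ intLattice ∨ E 3 ∈ intLattice ∧ ∃ c : ℝ,
    E 4 + E 5 + E 6 + E 7 + c • E 3 ∈ intLattice := h.translate 3
  rw [o5, o6, o7, o8] at hc
  rw [o5] at t1
  rw [o5, o6] at t2
  rw [o5, o6, o7] at t3
  generalize E 0 = e0, E 1 = e1, E 2 = e2, E 3 = e3, E 4 = e4 at *
  have ms : ∀ {x y z : Plane}, x ∈ intLattice → y ∈ intLattice → z = x - y → z ∈ intLattice :=
    fun hx hy e => e ▸ sub_mem hx hy
  -- Crossing with the edge itself removes the unknown sliding multiple, leaving an integer.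
  have ic : ∀ {x y : Plane} {r s : ℝ}, y ∈ intLattice → x + r • y ∈ intLattice →
      -cross x y = s → s ∈ (Int.castAddHom ℝ).range := by
    intro x y r s hy hx e
    have := neg_mem (cross_mem_intCast hx hy)
    rwa [cross_add_left, cross_smul_left, cross_same, mul_zero, add_zero, e] at this
  have sixA := fun m1 m2 m3 => six_le_sum_cross m1 m2 m3 h4 p12 p13 p14 p23 p24 p34
  have sixB := fun m1 m2 m3 => six_le_sum_cross m1 m2 m3 h4 p02 p03 p04 p23 p24 p34
  have sixC := fun m1 m2 m3 => six_le_sum_cross m1 m2 m3 h4 p01 p03 p04 p13 p14 p34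
  have sixD := fun m1 m2 m3 => six_le_sum_cross m1 m2 m3 h4 p01 p02 p04 p12 p14 p24
  -- If exactly one of the other four is exceptional, the ten cross products are grouped into blocks
  -- bounded below by 1, 1, 2 and 2. In all other cases four of the five edges are lattice vectors,
  -- and their six cross products alone give six.
  rcases t0 with a0 | ⟨m0, c0, t0⟩ <;> rcases t1 with a1 | ⟨m1, c1, t1⟩ <;>
    rcases t2 with a2 | ⟨m2, c2, t2⟩ <;> rcases t3 with a3 | ⟨m3, c3, t3⟩
  · have b1 : e1 + e2 ∈ intLattice := ms a1 a2 (by abel)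
    have b2 : e2 + e3 ∈ intLattice := ms a2 a3 (by abel)
    have b3 : e1 + e2 + e3 ∈ intLattice := ms a0 h4 (by abel)
    have m1 : e1 ∈ intLattice := ms b3 b2 (by abel)
    linarith [sixA m1 (ms b1 m1 (by abel)) (ms b3 b1 (by abel))]
  · have hp : e0 + e1 ∈ intLattice := ms a0 a1 (by abel)
    have hq : e1 + e2 ∈ intLattice := ms a1 a2 (by abel)
    have c1 : 1 ≤ cross (e0 + e1) (e1 + e2) := one_le_of_mem_intCast (cross_mem_intCast hp hq) (by
      simp only [cross_add_left, cross_add_right, cross_same]; linarith)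
    have c2 : 1 ≤ cross e3 e4 := one_le_of_mem_intCast (cross_mem_intCast m3 h4) p34
    have c3 : 2 ≤ cross (e0 + e1) e4 + cross e2 e4 :=
      two_le_add (x := cross e3 e4) (ic h4 hc (by
        simp only [cross, PiLp.add_apply, PiLp.neg_apply]; ring))
        (cross_mem_intCast m3 h4) (cross_mem_intCast hp h4)
        (by rw [cross_add_left]; linarith) (by assumption)
    have c4 : 2 ≤ cross (e0 + e1) e3 + cross e2 e3 :=
      two_le_add (x := cross e3 e4) (ic m3 t3 (by
        simp only [cross, PiLp.add_apply, PiLp.neg_apply]; ring))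
        (cross_mem_intCast m3 h4) (cross_mem_intCast hp m3)
        (by simp only [cross_add_left]; linarith) (by assumption)
    simp only [cross_add_left, cross_add_right, cross_same] at c1 c3 c4
    linarith
  · have hp : e0 + e1 ∈ intLattice := ms a0 a1 (by abel)
    have hq : e1 + e3 ∈ intLattice := ms (ms a0 h4 rfl) m2 (by abel)
    have c1 : 1 ≤ cross (e0 + e1) (e1 + e3) := one_le_of_mem_intCast (cross_mem_intCast hp hq) (by
      simp only [cross_add_left, cross_add_right, cross_same]; linarith)
    have c2 : 1 ≤ cross e2 e4 := one_le_of_mem_intCast (cross_mem_intCast m2 h4) p24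
    have c3 : 2 ≤ cross (e0 + e1) e4 + cross e3 e4 :=
      two_le_add (x := cross e2 e4) (ic h4 hc (by
        simp only [cross, PiLp.add_apply, PiLp.neg_apply]; ring))
        (cross_mem_intCast m2 h4) (cross_mem_intCast hp h4)
        (by rw [cross_add_left]; linarith) (by assumption)
    have c4 : 2 ≤ cross (e0 + e1) e2 + cross e2 e3 :=
      two_le_add (x := cross e2 e4) (ic m2 t2 (by
        simp only [cross, PiLp.add_apply, PiLp.neg_apply]; ring))
        (cross_mem_intCast m2 h4) (cross_mem_intCast hp m2)
        (by simp only [cross_add_left]; linarith) (by assumption)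
    simp only [cross_add_left, cross_add_right, cross_same] at c1 c3 c4
    linarith
  · have b3 : e1 + e2 + e3 ∈ intLattice := ms a0 h4 (by abel)
    have m1 : e1 ∈ intLattice := ms (ms b3 m2 rfl) m3 (by abel)
    linarith [sixA m1 m2 m3]
  · have hp : e0 + e2 ∈ intLattice := ms (ms h4 m1 rfl) a3 (by abel)
    have hq : e2 + e3 ∈ intLattice := ms a2 a3 (by abel)
    have c1 : 1 ≤ cross (e0 + e2) (e2 + e3) := one_le_of_mem_intCast (cross_mem_intCast hp hq) (by
      simp only [cross_add_left, cross_add_right, cross_same]; linarith)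
    have c2 : 1 ≤ cross e1 e4 := one_le_of_mem_intCast (cross_mem_intCast m1 h4) p14
    have c3 : 2 ≤ cross (e0 + e2) e4 + cross e3 e4 :=
      two_le_add (x := cross e1 e4) (ic h4 hc (by
        simp only [cross, PiLp.add_apply, PiLp.neg_apply]; ring))
        (cross_mem_intCast m1 h4) (cross_mem_intCast hp h4)
        (by rw [cross_add_left]; linarith) (by assumption)
    have c4 : 2 ≤ cross e1 (e2 + e3) + cross e0 e1 :=
      two_le_add (x := cross e1 e4) (ic m1 t1 (by
        simp only [cross, PiLp.add_apply, PiLp.neg_apply]; ring))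
        (cross_mem_intCast m1 h4) (cross_mem_intCast m1 hq)
        (by simp only [cross_add_right]; linarith) (by assumption)
    simp only [cross_add_left, cross_add_right, cross_same] at c1 c3 c4
    linarith
  · have b3 : e1 + e2 + e3 ∈ intLattice := ms a0 h4 (by abel)
    have m2 : e2 ∈ intLattice := ms (ms b3 m1 rfl) m3 (by abel)
    linarith [sixA m1 m2 m3]
  · have b3 : e1 + e2 + e3 ∈ intLattice := ms a0 h4 (by abel)
    have m3 : e3 ∈ intLattice := ms (ms b3 m1 rfl) m2 (by abel)
    linarith [sixA m1 m2 m3]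
  · linarith [sixA m1 m2 m3]
  · have hp : e1 + e2 ∈ intLattice := ms a1 a2 (by abel)
    have hq : e2 + e3 ∈ intLattice := ms a2 a3 (by abel)
    have c1 : 1 ≤ cross (e1 + e2) (e2 + e3) := one_le_of_mem_intCast (cross_mem_intCast hp hq) (by
      simp only [cross_add_left, cross_add_right, cross_same]; linarith)
    have c2 : 1 ≤ cross e0 e4 := one_le_of_mem_intCast (cross_mem_intCast m0 h4) p04
    have c3 : 2 ≤ cross (e1 + e2) e4 + cross e3 e4 :=
      two_le_add (x := cross e0 e4) (ic h4 hc (by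
        simp only [cross, PiLp.add_apply, PiLp.neg_apply]; ring))
        (cross_mem_intCast m0 h4) (cross_mem_intCast hp h4)
        (by rw [cross_add_left]; linarith) (by assumption)
    have c4 : 2 ≤ cross e0 (e1 + e2) + cross e0 e3 :=
      two_le_add (x := cross e0 e4) (ic m0 t0 (by simp only [cross, PiLp.add_apply]; ring))
        (cross_mem_intCast m0 h4) (cross_mem_intCast m0 hp)
        (by simp only [cross_add_right]; linarith) (by assumption)
    simp only [cross_add_left, cross_add_right, cross_same] at c1 c3 c4
    linarith
  · have b3 : e2 + e3 + -e0 ∈ intLattice := ms a1 h4 (by abel)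
    have m2 : e2 ∈ intLattice := ms (ms b3 m3 rfl) (neg_mem m0) (by abel)
    linarith [sixB m0 m2 m3]
  · have b3 : e2 + e3 + -e0 ∈ intLattice := ms a1 h4 (by abel)
    have m3 : e3 ∈ intLattice := ms (ms b3 m2 rfl) (neg_mem m0) (by abel)
    linarith [sixB m0 m2 m3]
  · linarith [sixB m0 m2 m3]
  · have b3 : e3 + -e0 + -e1 ∈ intLattice := ms a2 h4 (by abel)
    have m3 : e3 ∈ intLattice := ms (ms b3 (neg_mem m1) rfl) (neg_mem m0) (by abel)
    linarith [sixC m0 m1 m3]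
  · linarith [sixC m0 m1 m3]
  · linarith [sixD m0 m1 m2]
  · linarith [sixA m1 m2 m3]

/-! ### Integer classification of the short diagonals. -/

-- The singleton lists act as assignments: only the `x`'s and `y₀` are searched, the linear
-- relations yield the other `y`'s. One Plücker relation is tested before `y₃` is introduced, to
-- prune early.
set_option synthInstance.maxHeartbeats 400000 in
set_option synthInstance.maxSize 2000 in
lemma cyclic_int_classification_aux : ∀ x₀ ∈ Finset.Icc (1 : ℤ) 5, ∀ x₁ ∈ Finset.Icc (1 : ℤ) 5,
    ∀ x₂ ∈ Finset.Icc (1 : ℤ) 5, ∀ x₃ ∈ Finset.Icc (1 : ℤ) 5, ∀ x₄ ∈ Finset.Icc (1 : ℤ) 5,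
    x₀ + x₁ + x₂ + x₃ + x₄ ≤ 9 → ∀ y₀ ∈ Finset.Icc (1 : ℤ) 11, ∀ y₂ ∈ [y₀ + x₂ - x₁],
    ∀ y₄ ∈ [y₂ + x₄ - x₃], ∀ y₁ ∈ [y₄ + x₁ - x₀], x₄ * x₁ + x₀ * y₂ = y₄ * y₀ →
    ∀ y₃ ∈ [y₁ + x₃ - x₂], x₀ * x₂ + x₁ * y₃ = y₀ * y₁ → x₁ * x₃ + x₂ * y₄ = y₁ * y₂ →
    x₂ * x₄ + x₃ * y₀ = y₂ * y₃ → x₃ * x₀ + x₄ * y₁ = y₃ * y₄ →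
    1 ≤ y₁ → 1 ≤ y₂ → 1 ≤ y₃ → 1 ≤ y₄ →
    2 * (x₀ + x₁ + x₂ + x₃ + x₄) + (y₀ + y₁ + y₂ + y₃ + y₄) ≤ 25 →
    x₀ = 1 ∧ x₁ = 1 ∧ y₀ = 2 ∧ y₁ = 2 ∧ y₃ = 2 ∨ x₁ = 1 ∧ x₂ = 1 ∧ y₁ = 2 ∧ y₂ = 2 ∧ y₄ = 2 ∨
    x₂ = 1 ∧ x₃ = 1 ∧ y₂ = 2 ∧ y₃ = 2 ∧ y₀ = 2 ∨ x₃ = 1 ∧ x₄ = 1 ∧ y₃ = 2 ∧ y₄ = 2 ∧ y₁ = 2 ∨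
    x₄ = 1 ∧ x₀ = 1 ∧ y₄ = 2 ∧ y₀ = 2 ∧ y₂ = 2 := by
  decide +kernel

/-- The possible cross products of short diagonals of a centrally symmetric lattice decagon. -/
lemma cyclic_int_classification {x₀ x₁ x₂ x₃ x₄ y₀ y₁ y₂ y₃ y₄ : ℤ}
    (hx₀ : 1 ≤ x₀) (hx₁ : 1 ≤ x₁) (hx₂ : 1 ≤ x₂) (hx₃ : 1 ≤ x₃) (hx₄ : 1 ≤ x₄)
    (hy₀ : 1 ≤ y₀) (hy₁ : 1 ≤ y₁) (hy₂ : 1 ≤ y₂) (hy₃ : 1 ≤ y₃) (hy₄ : 1 ≤ y₄)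
    (l₂ : y₂ = y₀ + x₂ - x₁) (l₄ : y₄ = y₂ + x₄ - x₃) (l₁ : y₁ = y₄ + x₁ - x₀)
    (l₃ : y₃ = y₁ + x₃ - x₂) (q₀ : x₀ * x₂ + x₁ * y₃ = y₀ * y₁)
    (q₁ : x₁ * x₃ + x₂ * y₄ = y₁ * y₂) (q₂ : x₂ * x₄ + x₃ * y₀ = y₂ * y₃)
    (q₃ : x₃ * x₀ + x₄ * y₁ = y₃ * y₄) (q₄ : x₄ * x₁ + x₀ * y₂ = y₄ * y₀)
    (hα : x₀ + x₁ + x₂ + x₃ + x₄ < 2 * (y₀ + y₁ + y₂ + y₃ + y₄))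
    (area : 2 * (x₀ + x₁ + x₂ + x₃ + x₄) + (y₀ + y₁ + y₂ + y₃ + y₄) ≤ 25) :
    x₀ = 1 ∧ x₁ = 1 ∧ y₀ = 2 ∧ y₁ = 2 ∧ y₃ = 2 ∨ x₁ = 1 ∧ x₂ = 1 ∧ y₁ = 2 ∧ y₂ = 2 ∧ y₄ = 2 ∨
    x₂ = 1 ∧ x₃ = 1 ∧ y₂ = 2 ∧ y₃ = 2 ∧ y₀ = 2 ∨ x₃ = 1 ∧ x₄ = 1 ∧ y₃ = 2 ∧ y₄ = 2 ∧ y₁ = 2 ∨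
    x₄ = 1 ∧ x₀ = 1 ∧ y₄ = 2 ∧ y₀ = 2 ∧ y₂ = 2 := by
  -- With `X` and `Y` the sums of the `x`'s and `y`'s, `2X + Y ≤ 25` and `X < 2Y` give `X ≤ 9`, so
  -- each `x` is at most 5. As `X ≥ 5`, also `Y ≤ 15`, so `y₀ ≤ 11`.
  refine cyclic_int_classification_aux x₀ (Finset.mem_Icc.2 ?_) x₁ (Finset.mem_Icc.2 ?_) x₂
    (Finset.mem_Icc.2 ?_) x₃ (Finset.mem_Icc.2 ?_) x₄ (Finset.mem_Icc.2 ?_) ?_ y₀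
    (Finset.mem_Icc.2 ?_) y₂ (List.mem_singleton.2 l₂) y₄ (List.mem_singleton.2 l₄) y₁
    (List.mem_singleton.2 l₁) q₄ y₃ (List.mem_singleton.2 l₃) q₀ q₁ q₂ q₃ hy₁ hy₂ hy₃ hy₄ area
    <;> omega

lemma IsLatticeEdgeSystem.sum_mem {E : Fin 10 → Plane} (h : IsLatticeEdgeSystem E) (i : Fin 10) :
    E (i + 1) + E (i + 2) + E (i + 3) + E (i + 4) ∈ intLattice := by
  rcases h.translate i with hi | ⟨hi, c, hc⟩
  · exact hi
  · refine ((h.shift (i - 4)).last_not_exceptional (c := c) ?_ ?_).elim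
    · rwa [add_sub_cancel]
    · have e : ∀ j : Fin 10, j + 4 + (i - 4) = i + j := fun j => by abel
      rw [← e 1, ← e 2, ← e 3, ← e 4] at hc
      rwa [add_sub_cancel]

/-- Consecutive four-edge sums differ by `E (i + 1) - E (i + 5)`, and `E (i + 5) = -E i`. -/
lemma IsLatticeEdgeSystem.add_mem {E : Fin 10 → Plane} (h : IsLatticeEdgeSystem E) (i : Fin 10) :
    E i + E (i + 1) ∈ intLattice := by
  have h1 := sub_mem (h.sum_mem i) (h.sum_mem (i + 1))
  have o : E (i + 1 + 4) = -E i := by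
    rw [← h.opposite i, add_assoc]; rfl
  have e2 : E (i + 1 + 1) = E (i + 2) := by rw [add_assoc]; rfl
  have e3 : E (i + 1 + 2) = E (i + 3) := by rw [add_assoc]; rfl
  have e4 : E (i + 1 + 3) = E (i + 4) := by rw [add_assoc]; rfl
  rw [o, e2, e3, e4] at h1
  convert h1 using 1
  abel

lemma exists_int_of_mem_intLattice {a b : Plane} (ha : a ∈ intLattice) (hb : b ∈ intLattice)
    (h : 0 < cross a b) : ∃ n : ℤ, cross a b = n ∧ 1 ≤ n := by
  obtain ⟨n, hn⟩ := cross_mem_intCast ha hb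
  rw [← hn] at h ⊢
  simp only [Int.coe_castAddHom] at h ⊢
  exact ⟨n, rfl, by exact_mod_cast h⟩

/-- Five vectors in a half-plane, sorted by angle, span a zonogon; if its short diagonals are
lattice vectors and its area is at most five, the cross products of the diagonals are determined. -/
lemma cross_short_diagonals {e₀ e₁ e₂ e₃ e₄ : Plane} (p₀ : 0 < cross e₀ e₁) (p₁ : 0 < cross e₁ e₂)
    (p₂ : 0 < cross e₂ e₃) (p₃ : 0 < cross e₃ e₄) (p₄ : 0 < cross e₀ e₄) (r₀ : 0 < cross e₀ e₂)
    (r₁ : 0 < cross e₁ e₃) (r₂ : 0 < cross e₂ e₄) (r₃ : 0 < cross e₀ e₃) (r₄ : 0 < cross e₁ e₄)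
    (m₀ : e₀ + e₁ ∈ intLattice) (m₁ : e₁ + e₂ ∈ intLattice) (m₂ : e₂ + e₃ ∈ intLattice)
    (m₃ : e₃ + e₄ ∈ intLattice) (m₄ : e₄ + -e₀ ∈ intLattice)
    (area : cross e₀ e₁ + cross e₁ e₂ + cross e₂ e₃ + cross e₃ e₄ + cross e₀ e₄ + cross e₀ e₂ +
      cross e₁ e₃ + cross e₂ e₄ + cross e₀ e₃ + cross e₁ e₄ ≤ 5) :
    ∃ x₀ x₁ x₂ x₃ x₄ y₀ y₁ y₂ y₃ y₄ : ℤ,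
      cross (e₀ + e₁) (e₁ + e₂) = x₀ ∧ cross (e₁ + e₂) (e₂ + e₃) = x₁ ∧
      cross (e₂ + e₃) (e₃ + e₄) = x₂ ∧ cross (e₃ + e₄) (e₄ + -e₀) = x₃ ∧
      cross (e₀ + e₁) (e₄ + -e₀) = x₄ ∧ cross (e₀ + e₁) (e₂ + e₃) = y₀ ∧
      cross (e₁ + e₂) (e₃ + e₄) = y₁ ∧ cross (e₂ + e₃) (e₄ + -e₀) = y₂ ∧
      cross (e₀ + e₁) (e₃ + e₄) = y₃ ∧ cross (e₁ + e₂) (e₄ + -e₀) = y₄ ∧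
      (x₀ = 1 ∧ x₁ = 1 ∧ y₀ = 2 ∧ y₁ = 2 ∧ y₃ = 2 ∨ x₁ = 1 ∧ x₂ = 1 ∧ y₁ = 2 ∧ y₂ = 2 ∧ y₄ = 2 ∨
      x₂ = 1 ∧ x₃ = 1 ∧ y₂ = 2 ∧ y₃ = 2 ∧ y₀ = 2 ∨ x₃ = 1 ∧ x₄ = 1 ∧ y₃ = 2 ∧ y₄ = 2 ∧ y₁ = 2 ∨
      x₄ = 1 ∧ x₀ = 1 ∧ y₄ = 2 ∧ y₀ = 2 ∧ y₂ = 2) := by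
  have s₀ := cross_swap e₀ e₁
  have s₁ := cross_swap e₀ e₂
  have s₂ := cross_swap e₀ e₃
  have s₃ := cross_swap e₀ e₄
  obtain ⟨x₀, hx₀, ix₀⟩ := exists_int_of_mem_intLattice m₀ m₁
    (by simp only [cross_add_left, cross_add_right, cross_same]; linarith)
  obtain ⟨x₁, hx₁, ix₁⟩ := exists_int_of_mem_intLattice m₁ m₂
    (by simp only [cross_add_left, cross_add_right, cross_same]; linarith)
  obtain ⟨x₂, hx₂, ix₂⟩ := exists_int_of_mem_intLattice m₂ m₃
    (by simp only [cross_add_left, cross_add_right, cross_same]; linarith)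
  obtain ⟨x₃, hx₃, ix₃⟩ := exists_int_of_mem_intLattice m₃ m₄
    (by simp only [cross_add_left, cross_add_right, cross_neg_right, cross_same]; linarith)
  obtain ⟨x₄, hx₄, ix₄⟩ := exists_int_of_mem_intLattice m₀ m₄
    (by simp only [cross_add_left, cross_add_right, cross_neg_right, cross_same]; linarith)
  obtain ⟨y₀, hy₀, iy₀⟩ := exists_int_of_mem_intLattice m₀ m₂
    (by simp only [cross_add_left, cross_add_right]; linarith)
  obtain ⟨y₁, hy₁, iy₁⟩ := exists_int_of_mem_intLattice m₁ m₃
    (by simp only [cross_add_left, cross_add_right]; linarith)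
  obtain ⟨y₂, hy₂, iy₂⟩ := exists_int_of_mem_intLattice m₂ m₄
    (by simp only [cross_add_left, cross_add_right, cross_neg_right]; linarith)
  obtain ⟨y₃, hy₃, iy₃⟩ := exists_int_of_mem_intLattice m₀ m₃
    (by simp only [cross_add_left, cross_add_right]; linarith)
  obtain ⟨y₄, hy₄, iy₄⟩ := exists_int_of_mem_intLattice m₁ m₄
    (by simp only [cross_add_left, cross_add_right, cross_neg_right]; linarith)
  refine ⟨x₀, x₁, x₂, x₃, x₄, y₀, y₁, y₂, y₃, y₄, hx₀, hx₁, hx₂, hx₃, hx₄, hy₀, hy₁, hy₂, hy₃,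
    hy₄, cyclic_int_classification ix₀ ix₁ ix₂ ix₃ ix₄ iy₀ iy₁ iy₂ iy₃ iy₄ ?_ ?_ ?_ ?_ ?_ ?_ ?_ ?_
    ?_ ?_ ?_⟩
  -- Four linear relations, from crossing the vanishing alternating sum of the five diagonals with
  -- four of them, and five Plücker relations. The two remaining goals are the inequalities: `2 * X
  -- + Y` is five times the area, and `2 * Y - X` is five times a sum of positive cross products.
  iterate 9
    rify
    simp only [← hx₀, ← hx₁, ← hx₂, ← hx₃, ← hx₄, ← hy₀, ← hy₁, ← hy₂, ← hy₃, ← hy₄]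
    simp only [cross, PiLp.add_apply, PiLp.neg_apply]
    ring
  all_goals
    rify
    rw [← hx₀, ← hx₁, ← hx₂, ← hx₃, ← hx₄, ← hy₀, ← hy₁, ← hy₂, ← hy₃, ← hy₄]
    simp only [cross_add_left, cross_add_right, cross_neg_right, cross_same]
    linarith

/-- Up to rotation, only one system of cross products is possible. -/
lemma IsLatticeEdgeSystem.exists_cross_eq {E : Fin 10 → Plane} (h : IsLatticeEdgeSystem E) :
    ∃ k, cross (E k + E (k + 1)) (E (k + 1) + E (k + 2)) = 1 ∧
      cross (E (k + 1) + E (k + 2)) (E (k + 2) + E (k + 3)) = 1 ∧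
      cross (E k + E (k + 1)) (E (k + 2) + E (k + 3)) = 2 ∧
      cross (E (k + 1) + E (k + 2)) (E (k + 3) + E (k + 4)) = 2 ∧
      cross (E k + E (k + 1)) (E (k + 3) + E (k + 4)) = 2 := by
  have o5 : E 5 = -E 0 := h.opposite 0
  have o6 : E 6 = -E 1 := h.opposite 1
  have o7 : E 7 = -E 2 := h.opposite 2
  have o8 : E 8 = -E 3 := h.opposite 3
  have o9 : E 9 = -E 4 := h.opposite 4
  have p₄ : 0 < cross (E 4) (E 5) := h.cross_one 4
  have r₃ : 0 < cross (E 3) (E 5) := h.cross_two 3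
  have r₄ : 0 < cross (E 4) (E 6) := h.cross_two 4
  have m₄ : E 4 + E 5 ∈ intLattice := h.add_mem 4
  have area := h.area
  rw [sum_fin_ten] at area
  simp only [show (0 : Fin 10) + 1 = 1 from rfl, show (1 : Fin 10) + 1 = 2 from rfl,
    show (2 : Fin 10) + 1 = 3 from rfl, show (3 : Fin 10) + 1 = 4 from rfl,
    show (4 : Fin 10) + 1 = 5 from rfl, show (5 : Fin 10) + 1 = 6 from rfl,
    show (6 : Fin 10) + 1 = 7 from rfl, show (7 : Fin 10) + 1 = 8 from rfl,
    show (8 : Fin 10) + 1 = 9 from rfl, show (9 : Fin 10) + 1 = 0 from rfl,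
    show (0 : Fin 10) + 2 = 2 from rfl, show (1 : Fin 10) + 2 = 3 from rfl,
    show (2 : Fin 10) + 2 = 4 from rfl, show (3 : Fin 10) + 2 = 5 from rfl,
    show (4 : Fin 10) + 2 = 6 from rfl, show (5 : Fin 10) + 2 = 7 from rfl,
    show (6 : Fin 10) + 2 = 8 from rfl, show (7 : Fin 10) + 2 = 9 from rfl,
    show (8 : Fin 10) + 2 = 0 from rfl, show (9 : Fin 10) + 2 = 1 from rfl, o5, o6, o7, o8, o9,
    cross_neg_left, cross_neg_right, neg_neg] at area
  rw [o5] at p₄ r₃ m₄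
  rw [o6] at r₄
  rw [cross_neg_right, ← cross_swap] at p₄ r₃ r₄
  have s₀ := cross_swap (E 0) (E 4)
  have s₁ := cross_swap (E 0) (E 3)
  have s₂ := cross_swap (E 1) (E 4)
  obtain ⟨x₀, x₁, x₂, x₃, x₄, y₀, y₁, y₂, y₃, y₄, hx₀, hx₁, hx₂, hx₃, hx₄, hy₀, hy₁, hy₂, hy₃,
    hy₄, hc⟩ := cross_short_diagonals (e₀ := E 0) (e₁ := E 1) (e₂ := E 2) (e₃ := E 3)
    (e₄ := E 4) (h.cross_one 0) (h.cross_one 1) (h.cross_one 2)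
    (h.cross_one 3) p₄ (h.cross_two 0) (h.cross_two 1) (h.cross_two 2) r₃ r₄ (h.add_mem 0)
    (h.add_mem 1) (h.add_mem 2) (h.add_mem 3) m₄ (by linarith)
  have n : ∀ a b : Plane, cross a (-b) = cross b a := fun a b => by
    rw [cross_neg_right, ← cross_swap]
  have nn : ∀ a b : Plane, cross (-a) (-b) = cross a b := fun a b => by
    rw [cross_neg_left, cross_neg_right, neg_neg]
  have g₄ : E 4 + -E 0 = E 4 + E 5 := by rw [o5]
  have g₅ : E 5 + E 6 = -(E 0 + E 1) := by rw [o5, o6]; abel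
  have g₆ : E 6 + E 7 = -(E 1 + E 2) := by rw [o6, o7]; abel
  have g₇ : E 7 + E 8 = -(E 2 + E 3) := by rw [o7, o8]; abel
  rw [g₄] at hx₃ hx₄ hy₂ hy₄
  -- The alternatives are the five rotations; indices running past 4 are folded back by the sign
  -- change under a shift by five.
  rcases hc with ⟨rfl, rfl, rfl, rfl, rfl⟩ | ⟨rfl, rfl, rfl, rfl, rfl⟩ | ⟨rfl, rfl, rfl, rfl, rfl⟩ |
    ⟨rfl, rfl, rfl, rfl, rfl⟩ | ⟨rfl, rfl, rfl, rfl, rfl⟩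
  · refine ⟨0, hx₀.trans ?_, hx₁.trans ?_, hy₀.trans ?_, hy₁.trans ?_, hy₃.trans ?_⟩ <;> norm_num
  · refine ⟨1, hx₁.trans ?_, hx₂.trans ?_, hy₁.trans ?_, hy₂.trans ?_, hy₄.trans ?_⟩ <;> norm_num
  · have e₁ : cross (E 3 + E 4) (E 5 + E 6) = 2 := by rw [g₅, n]; exact hy₃.trans (by norm_num)
    have e₂ : cross (E 2 + E 3) (E 5 + E 6) = 2 := by rw [g₅, n]; exact hy₀.trans (by norm_num)
    refine ⟨2, hx₂.trans ?_, hx₃.trans ?_, hy₂.trans ?_, e₁, e₂⟩ <;> norm_num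
  · have e₀ : cross (E 4 + E 5) (E 5 + E 6) = 1 := by rw [g₅, n]; exact hx₄.trans (by norm_num)
    have e₁ : cross (E 3 + E 4) (E 5 + E 6) = 2 := by rw [g₅, n]; exact hy₃.trans (by norm_num)
    have e₂ : cross (E 4 + E 5) (E 6 + E 7) = 2 := by rw [g₆, n]; exact hy₄.trans (by norm_num)
    have e₃ : cross (E 3 + E 4) (E 6 + E 7) = 2 := by rw [g₆, n]; exact hy₁.trans (by norm_num)
    exact ⟨3, hx₃.trans (by norm_num), e₀, e₁, e₂, e₃⟩
  · have e₀ : cross (E 4 + E 5) (E 5 + E 6) = 1 := by rw [g₅, n]; exact hx₄.trans (by norm_num)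
    have e₁ : cross (E 5 + E 6) (E 6 + E 7) = 1 := by
      rw [g₅, g₆, nn]; exact hx₀.trans (by norm_num)
    have e₂ : cross (E 4 + E 5) (E 6 + E 7) = 2 := by rw [g₆, n]; exact hy₄.trans (by norm_num)
    have e₃ : cross (E 5 + E 6) (E 7 + E 8) = 2 := by
      rw [g₅, g₇, nn]; exact hy₀.trans (by norm_num)
    have e₄ : cross (E 4 + E 5) (E 7 + E 8) = 2 := by rw [g₇, n]; exact hy₂.trans (by norm_num)
    exact ⟨4, e₀, e₁, e₂, e₃, e₄⟩

/-! ### Affine normal form and conclusion. -/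

/-- The edge vectors of a polygon. -/
def edgeVec (v : Fin 10 → Plane) (i : Fin 10) : Plane := v (i + 1) - v i

lemma IsKFoldTiling.edgeVec_add_five {k : ℕ} {v : Fin 10 → Plane} (hv : IsPosCycle v)
    (ht : IsKFoldTiling k (decagon v) intLattice) (i : Fin 10) :
    v (i + 5 + 1) - v (i + 5) = -(v (i + 1) - v i) := by
  have h : ∀ i, ∃ j ≠ i, v (j + 1) - v j = -(v (i + 1) - v i) := fun i => by
    obtain ⟨j, hj, he, -⟩ := ht.exists_opposite_edge hv i
    exact ⟨j, hj, he⟩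
  obtain ⟨j, -, he⟩ := h i
  rwa [← hv.opposite_edge_eq h i j he]

/-- A decagon that tiles is centrally symmetric. -/
lemma IsKFoldTiling.exists_center {k : ℕ} {v : Fin 10 → Plane} (hv : IsPosCycle v)
    (ht : IsKFoldTiling k (decagon v) intLattice) :
    ∃ c : Plane, ∀ i, v (i + 5) = (2 : ℝ) • c - v i := by
  have h : ∀ i, v (i + 1 + 5) + v (i + 1) = v (i + 5) + v i := fun i => by
    have := ht.edgeVec_add_five hv i
    rw [add_right_comm, sub_eq_iff_eq_add] at this
    rw [this]
    abel
  have hn : ∀ n : ℕ, v (idx n + 5) + v (idx n) = v (0 + 5) + v 0 := by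
    intro n
    induction n with
    | zero => rfl
    | succ n ih => rw [idx_succ, h, ih]
  refine ⟨(1 / 2 : ℝ) • (v (0 + 5) + v 0), fun i => ?_⟩
  obtain ⟨n, -, hi⟩ := exists_eq_add_idx 0 i
  rw [zero_add] at hi
  rw [hi, smul_smul, ← hn n]
  norm_num

/-- The four edges between an edge and its opposite add up to `v (i + 5) - v (i + 1)`, which by
central symmetry is the translation between these edges up to sign and sliding. The area field
restates the fan bound, both sums being twice the area. -/
lemma IsKFoldTiling.isLatticeEdgeSystem {v : Fin 10 → Plane} (hv : IsPosCycle v)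
    (ht : IsKFoldTiling 5 (decagon v) intLattice) : IsLatticeEdgeSystem (edgeVec v) where
  opposite := ht.edgeVec_add_five hv
  cross_one := hv.cross_edge_succ
  cross_two i := hv.cross_edge_pos i (k := 5) (m := 2) (by norm_num) (by norm_num) (by norm_num)
    (ht.edgeVec_add_five hv i)
  translate i := by
    obtain ⟨C, hC⟩ := ht.exists_center hv
    obtain ⟨j, hj, he, l, hl, c, hc, h⟩ := ht.exists_opposite_edge hv i
    obtain rfl := hv.opposite_edge_eq (fun i => by
      obtain ⟨j, hj, he, -⟩ := ht.exists_opposite_edge hv i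
      exact ⟨j, hj, he⟩) i j he
    have e : edgeVec v (i + 1) + edgeVec v (i + 2) + edgeVec v (i + 3) + edgeVec v (i + 4) =
        v (i + 5) - v (i + 1) := by
      unfold edgeVec
      simp only [add_assoc i]
      change v (i + 2) - v (i + 1) + (v (i + 3) - v (i + 2)) + (v (i + 4) - v (i + 3)) +
        (v (i + 5) - v (i + 4)) = v (i + 5) - v (i + 1)
      abel
    rw [add_right_comm i 5 1, hC (i + 1)] at hc
    have e' : v (i + 5) - v (i + 1) = -l - c • edgeVec v i := by
      rw [hC i]
      nth_rw 1 [hc]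
      unfold edgeVec
      module
    rw [e, e']
    rcases h with h | h
    · exact Or.inl (sub_mem (neg_mem hl) h)
    · exact Or.inr ⟨h, c, by rw [sub_add_cancel]; exact neg_mem hl⟩
  area := by
    obtain ⟨C, hC⟩ := ht.exists_center hv
    have h := ht.sum_cross_diag_le hv
    have h5 : v 5 = (2 : ℝ) • C - v 0 := hC 0
    have h6 : v 6 = (2 : ℝ) • C - v 1 := hC 1
    have h7 : v 7 = (2 : ℝ) • C - v 2 := hC 2
    have h8 : v 8 = (2 : ℝ) • C - v 3 := hC 3
    have h9 : v 9 = (2 : ℝ) • C - v 4 := hC 4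
    have d : ∀ m, diag v 0 m = v (idx m) - v 0 := fun m => by rw [diag, zero_add]
    simp only [Finset.sum_range_succ, Finset.sum_range_zero, d, idx] at h
    rw [sum_fin_ten]
    refine le_trans (le_of_eq ?_) (h.trans (by norm_num))
    unfold edgeVec
    change cross (v 1 - v 0) (v 2 - v 1) + cross (v 1 - v 0) (v 3 - v 2) +
      (cross (v 2 - v 1) (v 3 - v 2) + cross (v 2 - v 1) (v 4 - v 3)) +
      (cross (v 3 - v 2) (v 4 - v 3) + cross (v 3 - v 2) (v 5 - v 4)) +
      (cross (v 4 - v 3) (v 5 - v 4) + cross (v 4 - v 3) (v 6 - v 5)) +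
      (cross (v 5 - v 4) (v 6 - v 5) + cross (v 5 - v 4) (v 7 - v 6)) +
      (cross (v 6 - v 5) (v 7 - v 6) + cross (v 6 - v 5) (v 8 - v 7)) +
      (cross (v 7 - v 6) (v 8 - v 7) + cross (v 7 - v 6) (v 9 - v 8)) +
      (cross (v 8 - v 7) (v 9 - v 8) + cross (v 8 - v 7) (v 0 - v 9)) +
      (cross (v 9 - v 8) (v 0 - v 9) + cross (v 9 - v 8) (v 1 - v 0)) +
      (cross (v 0 - v 9) (v 1 - v 0) + cross (v 0 - v 9) (v 2 - v 1)) =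
      0 + cross (v 1 - v 0) (v 2 - v 0) + cross (v 2 - v 0) (v 3 - v 0) +
      cross (v 3 - v 0) (v 4 - v 0) + cross (v 4 - v 0) (v 5 - v 0) +
      cross (v 5 - v 0) (v 6 - v 0) + cross (v 6 - v 0) (v 7 - v 0) +
      cross (v 7 - v 0) (v 8 - v 0) + cross (v 8 - v 0) (v 9 - v 0)
    rw [h5, h6, h7, h8, h9]
    simp only [cross, PiLp.sub_apply, PiLp.smul_apply, smul_eq_mul]
    ring

/-- A linear automorphism with prescribed values on a basis of the integer lattice. -/
lemma exists_linearEquiv_of_cross_eq_one {a b a' b' : Plane} (h : cross a b = 1)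
    (h' : cross a' b' ≠ 0) : ∃ T : Plane ≃ₗ[ℝ] Plane, T a = a' ∧ T b = b' := by
  let T : Plane →ₗ[ℝ] Plane :=
    { toFun := fun x => cross x b • a' + cross a x • b'
      map_add' := fun x y => by rw [cross_add_left, cross_add_right]; module
      map_smul' := fun r x => by
        rw [cross_smul_left, cross_smul_right, RingHom.id_apply]; module }
  have hT : ∀ x, T x = cross x b • a' + cross a x • b' := fun _ => rfl
  have hinj : Function.Injective T := by
    refine (injective_iff_map_eq_zero T).2 fun x hx => ?_
    rw [hT] at hx
    have h1 : cross x b = 0 := by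
      have := congrArg (fun y => cross y b') hx
      simpa [cross_add_left, cross_smul_left, h'] using this
    have h2 : cross a x = 0 := by
      have := congrArg (fun y => cross a' y) hx
      simpa [cross_add_right, cross_smul_right, h'] using this
    have := cross_smul_eq a b x
    rwa [h, h1, h2, one_smul, zero_smul, zero_smul, add_zero] at this
  refine ⟨LinearEquiv.ofInjectiveEndo T hinj, ?_, ?_⟩
  · simp [hT, h]
  · simp [hT, h]

/-- With the centre at the origin, the known cross products express the third and fourth short
diagonals through the first two. With central symmetry, four consecutive short diagonals fix all
edge midpoints, though not the vertices; so it suffices to send the first two to their prescribed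
values. -/
lemma IsPosCycle.exists_affineEquiv {v : Fin 10 → Plane} (hv : IsPosCycle v)
    (ht : IsKFoldTiling 5 (decagon v) intLattice) :
    ∃ σ : Plane ≃ᵃ[ℝ] Plane, IsCentrallySymmetric (decagon (σ ∘ v)) ∧
      edgeMidpoints (σ ∘ v) = prescribedMidpoints := by
  obtain ⟨c, hc⟩ := ht.exists_center hv
  obtain ⟨k, x0, x1, y0, y1, y3⟩ := (ht.isLatticeEdgeSystem hv).exists_cross_eq
  let u : Fin 10 → Plane := fun i => v (i + k) - c
  have hu : ∀ i, u (i + 5) = -u i := fun i => by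
    simp only [u]
    rw [add_right_comm, hc]
    module
  have hb : ∀ i, edgeVec v (k + i) + edgeVec v (k + i + 1) = u (i + 2) - u i := fun i => by
    simp only [u, edgeVec]
    rw [show k + i + 1 + 1 = i + 2 + k by rw [show (2 : Fin 10) = 1 + 1 from rfl]; abel,
      add_comm k i]
    abel
  have b0 : edgeVec v k + edgeVec v (k + 1) = u 2 - u 0 := by
    have := hb 0
    rwa [add_zero, zero_add] at this
  have b1 : edgeVec v (k + 1) + edgeVec v (k + 2) = u 3 - u 1 := by
    have := hb 1
    rwa [add_assoc k] at this
  have b2 : edgeVec v (k + 2) + edgeVec v (k + 3) = u 4 - u 2 := by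
    have := hb 2
    rwa [add_assoc k] at this
  have b3 : edgeVec v (k + 3) + edgeVec v (k + 4) = u 5 - u 3 := by
    have := hb 3
    rwa [add_assoc k] at this
  rw [b0, b1] at x0
  rw [b1, b2] at x1
  rw [b0, b2] at y0
  rw [b1, b3] at y1
  rw [b0, b3] at y3
  -- In the basis of the first two diagonals, the third has coordinates `(-1, 2)` and the fourth
  -- `(-2, 2)`.
  have e2 := cross_smul_eq (u 2 - u 0) (u 3 - u 1) (u 4 - u 2)
  have e3 := cross_smul_eq (u 2 - u 0) (u 3 - u 1) (u 5 - u 3)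
  rw [cross_swap (u 4 - u 2), x0, x1, y0, one_smul] at e2
  rw [cross_swap (u 5 - u 3), x0, y1, y3, one_smul] at e3
  -- The targets are twice the first two differences of consecutive values of `cyclicMidpoint`.
  obtain ⟨T, T0, T1⟩ := exists_linearEquiv_of_cross_eq_one (a' := !₂[-1, -1]) (b' := !₂[0, -1]) x0
    (by simp [cross])
  let σ : Plane ≃ᵃ[ℝ] Plane := (AffineEquiv.constVAdd ℝ Plane (-c)).trans T.toAffineEquiv
  have hσ : ∀ x, σ x = T (x - c) := fun x => by simp [σ, sub_eq_neg_add]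
  have hσu : ∀ i, σ (v (i + k)) = T (u i) := fun i => hσ _
  refine ⟨σ, isCentrallySymmetric_decagon (c := 0) fun i => ?_, ?_⟩
  · simp only [Function.comp_apply, hσ]
    rw [hc, smul_zero, zero_sub, ← map_neg]
    congr 1
    module
  have h5 : u 5 = -u 0 := hu 0
  have h6 : u 6 = -u 1 := hu 1
  have h7 : u 7 = -u 2 := hu 2
  have h8 : u 8 = -u 3 := hu 3
  have h9 : u 9 = -u 4 := hu 4
  rw [h5] at e3
  have T2 : T (u 4) - T (u 2) = -!₂[-1, -1] + (2 : ℝ) • !₂[0, -1] := by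
    have := congrArg T e2
    rw [map_add, map_smul, map_smul, T0, T1, map_sub] at this
    rw [this]; module
  have T3 : -T (u 0) - T (u 3) = (-2 : ℝ) • !₂[-1, -1] + (2 : ℝ) • !₂[0, -1] := by
    have := congrArg T e3
    rw [map_add, map_smul, map_smul, T0, T1, map_sub, map_neg] at this
    exact this
  rw [map_sub] at T0 T1
  have hmid : ∀ i, T (u i) + T (u (i + 1)) = (2 : ℝ) • cyclicMidpoint i := by
    have q0 := fun j => congrArg (fun x : Plane => x j) T0
    have q1 := fun j => congrArg (fun x : Plane => x j) T1
    have q2 := fun j => congrArg (fun x : Plane => x j) T2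
    have q3 := fun j => congrArg (fun x : Plane => x j) T3
    simp only [PiLp.add_apply, PiLp.sub_apply, PiLp.neg_apply, PiLp.smul_apply, smul_eq_mul,
      Fin.forall_fin_two, Matrix.cons_val_zero, Matrix.cons_val_one] at q0 q1 q2 q3
    have r : ∀ i j : Fin 10, i + 1 = j → (∀ l, T (u i) l + T (u j) l = 2 * cyclicMidpoint i l) →
        T (u i) + T (u (i + 1)) = (2 : ℝ) • cyclicMidpoint i := by
      rintro i _ rfl h
      ext l
      simpa using h l
    intro i
    fin_cases i
    · refine r 0 1 rfl (Fin.forall_fin_two.2 ?_)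
      constructor <;> simp [cyclicMidpoint] <;> linarith
    · refine r 1 2 rfl (Fin.forall_fin_two.2 ?_)
      constructor <;> simp [cyclicMidpoint] <;> linarith
    · refine r 2 3 rfl (Fin.forall_fin_two.2 ?_)
      constructor <;> simp [cyclicMidpoint] <;> linarith
    · refine r 3 4 rfl (Fin.forall_fin_two.2 ?_)
      constructor <;> simp [cyclicMidpoint] <;> linarith
    · refine r 4 5 rfl (Fin.forall_fin_two.2 ?_)
      rw [h5]
      constructor <;> simp [cyclicMidpoint] <;> linarith
    · refine r 5 6 rfl (Fin.forall_fin_two.2 ?_)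
      rw [h5, h6]
      constructor <;> simp [cyclicMidpoint] <;> linarith
    · refine r 6 7 rfl (Fin.forall_fin_two.2 ?_)
      rw [h6, h7]
      constructor <;> simp [cyclicMidpoint] <;> linarith
    · refine r 7 8 rfl (Fin.forall_fin_two.2 ?_)
      rw [h7, h8]
      constructor <;> simp [cyclicMidpoint] <;> linarith
    · refine r 8 9 rfl (Fin.forall_fin_two.2 ?_)
      rw [h8, h9]
      constructor <;> simp [cyclicMidpoint] <;> linarith
    · refine r 9 0 rfl (Fin.forall_fin_two.2 ?_)
      rw [h9]
      constructor <;> simp [cyclicMidpoint] <;> linarith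
  rw [← range_cyclicMidpoint]
  unfold edgeMidpoints
  refine ((Equiv.addRight k).surjective.range_comp _).symm.trans
    (congrArg Set.range (funext fun i => ?_))
  have : i + k + 1 = i + 1 + k := add_right_comm _ _ _
  simp only [Function.comp_apply, Equiv.coe_addRight, midpoint_eq_smul, this, hσu, hmid]
  module

/-- Affine normal form of the decagons that are five-fold lattice tiles. -/
lemma exists_isPrescribedDecagon_image {p : Fin 10 → Plane} (hp : IsDecagonCycle p)
    (h : IsKFoldLatticeTile 5 (decagon p)) :
    ∃ (σ : Plane ≃ᵃ[ℝ] Plane) (v : Fin 10 → Plane),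
      IsPrescribedDecagon v ∧ σ '' decagon p = decagon v := by
  obtain ⟨σ₀, ht⟩ := h.exists_intLattice
  rw [← decagon_map] at ht
  obtain ⟨v, hv, hr, -⟩ := (hp.map σ₀).exists_isPosCycle
  have e : decagon v = decagon (σ₀ ∘ p) := by rw [decagon, decagon, hr]
  rw [← e] at ht
  obtain ⟨σ₁, hsymm, hmid⟩ := hv.exists_affineEquiv ht
  refine ⟨σ₀.trans σ₁, σ₁ ∘ v, ⟨IsDecagonCycle.map (Or.inl hv) σ₁, hsymm, hmid⟩, ?_⟩
  rw [decagon_map, e, decagon_map, ← Set.image_comp]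
  rfl

lemma IsPrescribedDecagon.isKFoldLatticeTile {v : Fin 10 → Plane} (h : IsPrescribedDecagon v) :
    IsKFoldLatticeTile 5 (decagon v) := by
  obtain ⟨w, hw, hr⟩ := exists_stdDecagon_of_isPrescribedDecagon h
  have := isKFoldLatticeTile_stdDecagon hw
  rwa [decagon, hr] at this

theorem theorem2 :
    -- a decagon with the prescribed midpoints is a five-fold tile iff it has a vertex in `int W`
    (∀ v : Fin 10 → Plane, IsPrescribedDecagon v →
      (IsKFoldLatticeTile 5 (decagon v) ↔ ∃ i, v i ∈ interior quadW)) ∧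
    -- every point of `int W` is a vertex of exactly one decagon with the prescribed midpoints
    (∀ w ∈ interior quadW, ∃! D : Set Plane,
      ∃ v : Fin 10 → Plane, IsPrescribedDecagon v ∧ decagon v = D ∧ ∃ i, v i = w) ∧
    -- up to affine maps, these are precisely the convex decagons that are five-fold lattice tiles
    (∀ p : Fin 10 → Plane, IsDecagonCycle p →
      [IsKFoldLatticeTile 5 (decagon p),
        ∃ (σ : Plane ≃ᵃ[ℝ] Plane) (v : Fin 10 → Plane),
          IsPrescribedDecagon v ∧ σ '' decagon p = decagon v,
        ∃ (σ : Plane ≃ᵃ[ℝ] Plane) (v : Fin 10 → Plane),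
          IsPrescribedDecagon v ∧ (∃ i, v i ∈ interior quadW) ∧
            σ '' decagon p = decagon v].TFAE) := by
  refine ⟨fun v hv => ⟨fun _ => exists_vertex_mem_interior_quadW hv,
      fun _ => hv.isKFoldLatticeTile⟩,
    fun w hw => existsUnique_prescribed hw, fun p hp => ?_⟩
  tfae_have 1 → 2 := exists_isPrescribedDecagon_image hp
  tfae_have 2 → 3 := fun ⟨σ, v, hv, h⟩ => ⟨σ, v, hv, exists_vertex_mem_interior_quadW hv, h⟩
  tfae_have 3 → 1 := fun ⟨σ, v, hv, _, h⟩ => .of_image σ (h ▸ hv.isKFoldLatticeTile)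
  tfae_finish
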